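/- Let $\mathbb{K}$ be a field of characteristic zero. For a $\mathbb{K}$-algebra $A$, the Gelfand--Kirillov dimension is $$\operatorname{GKdim} A=\sup_V\ \limsup_{n\to\infty}\frac{\log\dim_{\mathbb K}(\mathbb{K}+V+V^2+\dots+V^n)}{\log n},$$ the supremum being over all finite-dimensional subspaces $V\subseteq A$. We say that $A$ has polynomial growth if $\operatorname{GKdim}A<\infty$, and that $A$ has just infinite GK-dimension if $\operatorname{GKdim} A=\infty$ and $\operatorname{GKdim}(A/I)<\infty$ for every nonzero two-sided ideal $I$ of $A$. Let $W$ be the Witt algebra, i.e. the Lie algebra over $\mathbb{K}$ with basis $\{e_n : n\in\mathbb{Z}\}$ and bracket $[e_i,e_j]=(j-i)e_{i+j}$. Let $W_+$ be the Lie subalgebra of $W$ spanned by $\{e_n : n\ge 1\}$. Let $\mathrm{Vir}$ be the Virasoro algebra, with basis $\{e_n : n\in\mathbb{Z}\}\cup\{c\}$ and bracket $[e_i,e_j]=(j-i)e_{i+j}+\frac{i^3-i}{12}\delta_{i+j,0}\,c$, with $c$ central. For a Lie algebra $\mathfrak g$, let $U(\mathfrak g)$ denote its universal enveloping algebra. Theorem.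 The algebras $U(W_+)$, $U(W)$ and $U(\mathrm{Vir})/(c-\kappa)$, for every $\kappa\in\mathbb{K}$, have just infinite GK-dimension: each has infinite GK-dimension, and every quotient of it by a nonzero two-sided ideal has finite GK-dimension (polynomial growth). In particular, for every nonzero two-sided ideal $I$ of $U(W_+)$, the algebra $U(W_+)/I$ has polynomial growth, which is the conjecture of Petukhov and Sierra. -/

import Mathlib

/-! ### Gelfand–Kirillov dimension -/

/-- The Gelfand–Kirillov dimension of a `K`-algebra `A`: the supremum over all finite-dimensional
subspaces `V` of `limsup (log (dim (K + V + ⋯ + V ^ n)) / log n)`.  Here `1 : Submodule K A` is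
the line `K · 1`, so that `(1 ⊔ V) ^ n = K + V + ⋯ + V ^ n`. -/
noncomputable def gkDim (K : Type*) [Field K] (A : Type*) [Ring A] [Algebra K A] : ENNReal :=
  ⨆ (V : Submodule K A) (_ : V.FG),
    Filter.limsup
      (fun n : ℕ => ENNReal.ofReal
        (Real.log (Module.finrank K ((1 ⊔ V) ^ n : Submodule K A)) / Real.log n))
      Filter.atTop

/-- `A` has just infinite GK-dimension: the GK-dimension of `A` is infinite, while every quotient
of `A` by a nonzero two-sided ideal has finite GK-dimension. -/
def HasJustInfiniteGKDim (K : Type*) [Field K] (A : Type*) [Ring A] [Algebra K A] : Prop :=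
  gkDim K A = ⊤ ∧ ∀ I : TwoSidedIdeal A, I ≠ ⊥ → gkDim K I.ringCon.Quotient < ⊤

/-! ### The Witt algebra -/

/-- The Witt algebra `W`, with basis `e n`, `n ∈ ℤ`. -/
def WittAlgebra (K : Type*) [Field K] : Type _ := ℤ →₀ K

namespace WittAlgebra

variable {K : Type*} [Field K]

noncomputable instance : AddCommGroup (WittAlgebra K) := inferInstanceAs (AddCommGroup (ℤ →₀ K))

noncomputable instance : Module K (WittAlgebra K) := inferInstanceAs (Module K (ℤ →₀ K))

/-- The basis of the Witt algebra. -/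
noncomputable def basis (K : Type*) [Field K] : Module.Basis ℤ K (WittAlgebra K) :=
  Module.Basis.ofRepr (LinearEquiv.refl K (ℤ →₀ K))

/-- The basis vector `e n` of the Witt algebra. -/
noncomputable def e (K : Type*) [Field K] (n : ℤ) : WittAlgebra K := basis K n

/-- The bilinear map with `(e i, e j) ↦ (j - i) e (i + j)`. -/
noncomputable def bracket (K : Type*) [Field K] :
    WittAlgebra K →ₗ[K] WittAlgebra K →ₗ[K] WittAlgebra K :=
  (basis K).constr K fun i => (basis K).constr K fun j => ((j : K) - (i : K)) • e K (i + j)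

theorem bracket_e (i j : ℤ) :
    bracket K (e K i) (e K j) = ((j : K) - (i : K)) • e K (i + j) := by
  simp [bracket, e]

theorem induction_e {p : WittAlgebra K → Prop} (zero : p 0) (add : ∀ x y, p x → p y → p (x + y))
    (smul : ∀ (a : K) (i : ℤ), p (a • e K i)) (x : WittAlgebra K) : p x := by
  rw [← (basis K).linearCombination_repr x, Finsupp.linearCombination_apply]
  exact Finset.sum_induction _ p add zero fun i _ => smul _ i

theorem bracket_skew (x y : WittAlgebra K) : bracket K x y = -bracket K y x := by
  have h : bracket K = -(bracket K).flip := by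
    refine (basis K).ext fun i => (basis K).ext fun j => ?_
    change bracket K (e K i) (e K j) = -bracket K (e K j) (e K i)
    rw [bracket_e, bracket_e, add_comm j i, ← neg_smul, neg_sub]
  simpa using congrArg (fun f => f x y) h

theorem bracket_self (x : WittAlgebra K) : bracket K x x = 0 := by
  induction x using induction_e with
  | zero => simp
  | add x y hx hy => simp [hx, hy, bracket_skew y x]
  | smul a i => simp [bracket_e]

theorem bracket_leibniz (x y z : WittAlgebra K) :
    bracket K x (bracket K y z) = bracket K (bracket K x y) z + bracket K y (bracket K x z) := by
  induction x using induction_e with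
  | zero => simp
  | add x x' hx hx' => simp only [map_add, LinearMap.add_apply, hx, hx']; abel
  | smul a i =>
  induction y using induction_e with
  | zero => simp
  | add y y' hy hy' => simp only [map_add, LinearMap.add_apply, hy, hy']; abel
  | smul b j =>
  induction z using induction_e with
  | zero => simp
  | add z z' hz hz' => simp only [map_add, hz, hz']; abel
  | smul c k =>
  simp only [map_smul, LinearMap.smul_apply, bracket_e, smul_smul, ← add_assoc, add_comm j i,
    ← add_smul]
  congr 1
  push_cast
  ring

noncomputable instance : LieRing (WittAlgebra K) where
  bracket x y := bracket K x y
  add_lie x y z := by simp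
  lie_add x y z := by simp
  lie_self x := bracket_self x
  leibniz_lie x y z := bracket_leibniz x y z

noncomputable instance : LieAlgebra K (WittAlgebra K) where
  lie_smul t x y := (bracket K x).map_smul t y

theorem lie_e_e (i j : ℤ) : ⁅e K i, e K j⁆ = ((j : K) - (i : K)) • e K (i + j) :=
  bracket_e i j

end WittAlgebra

/-- The positive Witt algebra `W₊`: the Lie subalgebra of `W` with underlying subspace the linear
span of the `e n` with `n ≥ 1`. -/
noncomputable def positiveWittAlgebra (K : Type*) [Field K] : LieSubalgebra K (WittAlgebra K) where
  toSubmodule := Submodule.span K (WittAlgebra.e K '' Set.Ici 1)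
  lie_mem' {x y} hx hy := by
    refine Submodule.span_induction₂
      (p := fun x y _ _ => ⁅x, y⁆ ∈ Submodule.span K (WittAlgebra.e K '' Set.Ici 1))
      ?_ ?_ ?_ ?_ ?_ ?_ ?_ hx hy
    · rintro _ _ ⟨i, hi, rfl⟩ ⟨j, hj, rfl⟩
      rw [WittAlgebra.lie_e_e]
      refine Submodule.smul_mem _ _ (Submodule.subset_span ⟨i + j, ?_, rfl⟩)
      simp only [Set.mem_Ici] at hi hj ⊢
      omega
    · intro y _; simp
    · intro x _; simp
    · intro x y z _ _ _ h h'; rw [add_lie]; exact add_mem h h'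
    · intro x y z _ _ _ h h'; rw [lie_add]; exact add_mem h h'
    · intro r x y _ _ h; rw [smul_lie]; exact Submodule.smul_mem _ r h
    · intro r x y _ _ h; rw [lie_smul]; exact Submodule.smul_mem _ r h

/-! ### The Virasoro algebra -/

/-- The Virasoro algebra, with basis `e n = (e n, 0)`, `n ∈ ℤ`, and `c = (0, 1)`. -/
def VirasoroAlgebra (K : Type*) [Field K] : Type _ := WittAlgebra K × K

namespace VirasoroAlgebra

variable {K : Type*} [Field K]

noncomputable instance : AddCommGroup (VirasoroAlgebra K) :=
  inferInstanceAs (AddCommGroup (WittAlgebra K × K))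

noncomputable instance : Module K (VirasoroAlgebra K) :=
  inferInstanceAs (Module K (WittAlgebra K × K))

/-- The basis vector `e n` of the Virasoro algebra. -/
noncomputable def e (K : Type*) [Field K] (n : ℤ) : VirasoroAlgebra K := (WittAlgebra.e K n, 0)

/-- The central basis vector `c` of the Virasoro algebra. -/
noncomputable def c (K : Type*) [Field K] : VirasoroAlgebra K := ((0 : WittAlgebra K), (1 : K))

/-- The bilinear form on `W` with `(e i, e j) ↦ (i ^ 3 - i) / 12` if `i + j = 0`, and
`(e i, e j) ↦ 0` otherwise. -/
noncomputable def cocycle (K : Type*) [Field K] :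
    WittAlgebra K →ₗ[K] WittAlgebra K →ₗ[K] K :=
  (WittAlgebra.basis K).constr K fun i => (WittAlgebra.basis K).constr K fun j =>
    if i + j = 0 then ((i : K) ^ 3 - (i : K)) / 12 else 0

theorem cocycle_e (i j : ℤ) :
    cocycle K (WittAlgebra.e K i) (WittAlgebra.e K j) =
      if i + j = 0 then ((i : K) ^ 3 - (i : K)) / 12 else 0 := by
  simp [cocycle, WittAlgebra.e]

theorem cocycle_skew (x y : WittAlgebra K) : cocycle K x y = -cocycle K y x := by
  have h : cocycle K = -(cocycle K).flip := by
    refine (WittAlgebra.basis K).ext fun i => (WittAlgebra.basis K).ext fun j => ?_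
    change cocycle K (WittAlgebra.e K i) (WittAlgebra.e K j) =
      -cocycle K (WittAlgebra.e K j) (WittAlgebra.e K i)
    rw [cocycle_e, cocycle_e, add_comm j i]
    split_ifs with hij
    · obtain rfl : j = -i := by omega
      push_cast
      ring
    · simp
  simpa using congrArg (fun f => f x y) h

theorem cocycle_self (x : WittAlgebra K) : cocycle K x x = 0 := by
  induction x using WittAlgebra.induction_e with
  | zero => simp
  | add x y hx hy => simp [hx, hy, cocycle_skew y x]
  | smul a i =>
    have h : i + i = 0 → (i : K) ^ 3 - (i : K) = 0 := by
      intro h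
      obtain rfl : i = 0 := by omega
      simp
    simp only [map_smul, LinearMap.smul_apply, cocycle_e]
    split_ifs with hi
    · simp [h hi]
    · simp

theorem cocycle_leibniz (x y z : WittAlgebra K) :
    cocycle K x ⁅y, z⁆ = cocycle K ⁅x, y⁆ z + cocycle K y ⁅x, z⁆ := by
  induction x using WittAlgebra.induction_e with
  | zero => simp
  | add x x' hx hx' => simp only [map_add, LinearMap.add_apply, add_lie, hx, hx']; abel
  | smul a i =>
  induction y using WittAlgebra.induction_e with
  | zero => simp
  | add y y' hy hy' => simp only [map_add, LinearMap.add_apply, add_lie, lie_add, hy, hy']; abel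
  | smul b j =>
  induction z using WittAlgebra.induction_e with
  | zero => simp
  | add z z' hz hz' => simp only [map_add, lie_add, hz, hz']; abel
  | smul d k =>
  simp only [smul_lie, lie_smul, map_smul, LinearMap.smul_apply, WittAlgebra.lie_e_e, cocycle_e,
    smul_eq_mul, ← add_assoc, add_comm j i]
  split_ifs with h
  · obtain rfl : k = -i - j := by omega
    push_cast
    ring
  · simp

noncomputable instance : LieRing (VirasoroAlgebra K) where
  bracket x y := (⁅x.1, y.1⁆, cocycle K x.1 y.1)
  add_lie x y z := Prod.ext (add_lie x.1 y.1 z.1)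
    (congrArg (fun f => f z.1) ((cocycle K).map_add x.1 y.1))
  lie_add x y z := Prod.ext (lie_add x.1 y.1 z.1) ((cocycle K x.1).map_add y.1 z.1)
  lie_self x := Prod.ext (lie_self x.1) (cocycle_self x.1)
  leibniz_lie x y z := Prod.ext (leibniz_lie x.1 y.1 z.1) (cocycle_leibniz x.1 y.1 z.1)

noncomputable instance : LieAlgebra K (VirasoroAlgebra K) where
  lie_smul t x y := Prod.ext (lie_smul t x.1 y.1) ((cocycle K x.1).map_smul t y.1)

theorem lie_e_e (i j : ℤ) :
    ⁅e K i, e K j⁆ = ((j : K) - (i : K)) • e K (i + j) +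
      (if i + j = 0 then ((i : K) ^ 3 - (i : K)) / 12 else 0) • c K := by
  refine Prod.ext ?_ ?_
  · change ⁅WittAlgebra.e K i, WittAlgebra.e K j⁆ =
      ((j : K) - (i : K)) • WittAlgebra.e K (i + j) +
        (if i + j = 0 then ((i : K) ^ 3 - (i : K)) / 12 else 0) • (0 : WittAlgebra K)
    rw [WittAlgebra.lie_e_e, smul_zero, add_zero]
  · change cocycle K (WittAlgebra.e K i) (WittAlgebra.e K j) =
      ((j : K) - (i : K)) • (0 : K) +
        (if i + j = 0 then ((i : K) ^ 3 - (i : K)) / 12 else 0) • (1 : K)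
    rw [cocycle_e, smul_zero, zero_add, smul_eq_mul, mul_one]

theorem lie_c (x : VirasoroAlgebra K) : ⁅x, c K⁆ = 0 :=
  Prod.ext (lie_zero x.1) ((cocycle K x.1).map_zero)

end VirasoroAlgebra

/-- The central quotient `U(Vir) / (c - κ)` of the enveloping algebra of the Virasoro algebra. -/
abbrev VirasoroCentralQuotient (K : Type*) [Field K] (κ : K) : Type _ :=
  (TwoSidedIdeal.span
    {UniversalEnvelopingAlgebra.ι K (VirasoroAlgebra.c K) -
      algebraMap K (UniversalEnvelopingAlgebra K (VirasoroAlgebra K)) κ}).ringCon.Quotient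

/-! Lower bound. The algebras act on `K[x j : j ∈ ℤ]` with `e n` acting as multiplication by `n • x
n` plus terms that do not raise the degree; the parameter `b` adjusts the central charge. Applied to
`1`, the ordered product of the powers `e s ^ a s`, `1 ≤ s ≤ d`, has leading monomial a nonzero
multiple of `∏ x s ^ a s`. So these products are linearly independent for every `d`, without appeal
to PBW, and the GK-dimension is infinite (`gkDim_eq_top`).

Upper bound. Let `x ≠ 0` lie in the ideal. Modulo shorter words, letters commute, so the top part of
a multiple of `x` is a symmetric combination `g` of words of length `k`; in the quotient it equals a
combination of shorter words. Commute this relation with `e (n 1), …, e (n k)`. By the Leibniz rule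
the leading part is a sum over maps `σ` recording which letter absorbs which `n s`. Now combine
these relations over exponent vectors `n`, with coefficients from a Laurent polynomial divisible by
a high power of every `1 - u s' / u s`. If `σ` is not injective, its word depends on two of the
exponents only through their sum and its coefficient is polynomial in `n`, so its contribution
vanishes. All permutations contribute the same by symmetry. The surviving relation has a unique
leading term, which can be placed at any prescribed decreasing word with large letters: such a word
is a combination of boundedly perturbed, lower words and of shorter ones
(`WittRelations.exists_word_mem`).

This rewriting rule applies whenever a word contains `k` large, well separated letters, and it
terminates. What remains are words whose letters cluster around `k + 1` centres, one of them `0`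
(`WittRelations.prod_mem_clusterSpan`). Such a multiset is given by its centres and boundedly many
multiplicities, so their number is polynomial in the weight. -/

/-! ### A polynomial representation of the Virasoro algebra -/

namespace PolynomialRep

open MvPolynomial

variable {K : Type*} [Field K]

/-- The derivation `x j ↦ j x (j + n) + b n² δ_{j + n, 0}`. -/
noncomputable def der (b : K) (n : ℤ) :
    Derivation K (MvPolynomial ℤ K) (MvPolynomial ℤ K) :=
  mkDerivation K fun j => (j : K) • X (j + n) + C (if j + n = 0 then b * (n : K) ^ 2 else 0)

theorem der_X (b : K) (n j : ℤ) :
    der b n (X j) = (j : K) • X (j + n) + C (if j + n = 0 then b * (n : K) ^ 2 else 0) := by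
  simp [der]

/-- The action of the basis vector `e n` on `K[x j : j ∈ ℤ]`. -/
noncomputable def op (b : K) (n : ℤ) : Module.End K (MvPolynomial ℤ K) :=
  LinearMap.mulLeft K ((n : K) • X n) + (der b n : MvPolynomial ℤ K →ₗ[K] MvPolynomial ℤ K) +
    (if n = 0 then b else 0) • 1

theorem op_apply (b : K) (n : ℤ) (p : MvPolynomial ℤ K) :
    op b n p = (n : K) • X n * p + der b n p + (if n = 0 then b else 0) • p := by
  by_cases h : n = 0 <;> simp [op, h]

/-- Both sides are derivations, so generators suffice. The constant `b * n ^ 2` is compatible with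
the bracket: at `j = -m - n` the constants give `j * b * (m² - n²) = (n - m) * b * (m + n)²`. -/
theorem lie_der (b : K) (m n : ℤ) : ⁅der b m, der b n⁆ = ((n : K) - m) • der b (m + n) := by
  refine derivation_ext fun j => ?_
  rw [Derivation.commutator_apply, Derivation.smul_apply]
  simp only [der_X, map_add, Derivation.map_smul, derivation_C, smul_add, add_zero]
  rw [add_assoc j n m, add_assoc j m n, add_comm n m]
  by_cases h : j + (m + n) = 0
  · obtain rfl : j = -m - n := by omega
    simp only [h, if_true, smul_eq_C_mul]
    push_cast
    simp only [map_sub, map_mul, map_add, map_neg, map_pow]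
    ring
  · simp only [h, if_false, smul_eq_C_mul]
    push_cast
    simp only [map_sub, map_add, map_zero]
    ring

/-- The multiplication terms contribute `(n² - m²) x (m + n)` and, for `n = -m`, the constant `-2 b
m³`. The scalar `b` in `op b 0` absorbs `-2 b m`, leaving `-2 b (m³ - m)`. This is `κ (m³ - m) / 12`
for `b = -κ / 24`. -/
theorem op_commutator [CharZero K] (κ : K) (m n : ℤ) :
    op (-κ / 24) m * op (-κ / 24) n - op (-κ / 24) n * op (-κ / 24) m =
      ((n : K) - m) • op (-κ / 24) (m + n) +
        ((if m + n = 0 then ((m : K) ^ 3 - m) / 12 else 0) * κ) • 1 := by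
  refine LinearMap.ext fun p => ?_
  have h := congrArg (fun D => D p) (lie_der (-κ / 24) m n)
  simp only [Derivation.commutator_apply, Derivation.smul_apply] at h
  rw [sub_eq_iff_eq_add] at h
  simp only [LinearMap.sub_apply, Module.End.mul_apply, LinearMap.add_apply, LinearMap.smul_apply,
    Module.End.one_apply, op_apply, map_add, Derivation.map_smul, Derivation.leibniz, h, der_X,
    smul_eq_mul]
  rw [add_comm n m]
  by_cases h0 : m + n = 0
  · obtain rfl : n = -m := by omega
    by_cases hm : m = 0
    · subst hm; simp
    · simp only [h0, hm, neg_eq_zero, if_true, if_false, smul_eq_C_mul]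
      have h24 : (C (-κ / 24) : MvPolynomial ℤ K) * 24 = - C κ := by
        rw [← map_ofNat C 24, ← map_mul, ← map_neg]; congr 1; field_simp
      have h12 : ((m : K) ^ 3 - m) / 12 * κ = (-κ / 24) * (-2 * ((m : K) ^ 3 - m)) := by
        field_simp; ring
      rw [h12]
      push_cast
      simp only [map_sub, map_mul, map_neg, map_pow, map_zero, map_ofNat]
      ring
  · simp only [h0, if_false, smul_eq_C_mul]
    push_cast
    simp only [map_sub, map_zero]
    by_cases hm : m = 0 <;> by_cases hn : n = 0 <;> simp [hm, hn] <;> ring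

/-- The polynomials of total degree less than `d`. -/
noncomputable def lowDegree (K : Type*) [Field K] (d : ℕ) : Submodule K (MvPolynomial ℤ K) :=
  restrictSupport K {m | m.degree < d}

theorem lowDegree_induction {d : ℕ} {S : Submodule K (MvPolynomial ℤ K)}
    {f : MvPolynomial ℤ K →ₗ[K] MvPolynomial ℤ K}
    (h : ∀ m : ℤ →₀ ℕ, m.degree < d → f (monomial m 1) ∈ S) {p : MvPolynomial ℤ K}
    (hp : p ∈ lowDegree K d) : f p ∈ S := by
  rw [lowDegree, restrictSupport_eq_span] at hp
  exact (Submodule.span_le (p := S.comap f)).2 (by rintro _ ⟨m, hm, rfl⟩; exact h m hm) hp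

theorem monomial_mem_lowDegree {d : ℕ} {m : ℤ →₀ ℕ} (h : m.degree < d) (r : K) :
    monomial m r ∈ lowDegree K d :=
  (monomial_mem_restrictSupport K).2 (Or.inl h)

theorem lowDegree_mono {d d' : ℕ} (h : d ≤ d') : lowDegree K d ≤ lowDegree K d' :=
  restrictSupport_mono K fun _ hm => lt_of_lt_of_le hm h

theorem X_mul_monomial_mem {d : ℕ} {m : ℤ →₀ ℕ} (h : m.degree < d) (n : ℤ) (r : K) :
    X n * monomial m r ∈ lowDegree K (d + 1) := by
  rw [X, monomial_mul]
  refine monomial_mem_lowDegree ?_ _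
  rw [map_add, Finsupp.degree_single]
  omega

/-- A derivation replaces one variable at a time, here by a polynomial of degree at most one, so the
total degree does not grow. -/
theorem der_monomial_mem (b : K) (n : ℤ) (m : ℤ →₀ ℕ) (r : K) :
    der b n (monomial m r) ∈ lowDegree K (m.degree + 1) := by
  rw [der, mkDerivation_monomial]
  refine Submodule.smul_mem _ _ (Submodule.sum_mem _ fun i hi => ?_)
  have hd : (m - Finsupp.single i 1).degree < m.degree := by
    have hle : Finsupp.single i 1 ≤ m := by
      rw [Finsupp.single_le_iff]; exact Nat.one_le_iff_ne_zero.2 (Finsupp.mem_support_iff.1 hi)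
    have := congrArg Finsupp.degree (tsub_add_cancel_of_le hle)
    rw [map_add, Finsupp.degree_single] at this
    omega
  beta_reduce
  rw [smul_eq_mul, mul_comm, add_mul, smul_mul_assoc, C_mul_monomial]
  exact add_mem (Submodule.smul_mem _ _ (X_mul_monomial_mem hd _ _))
    (monomial_mem_lowDegree (by omega) _)

/-- `p` is a nonzero multiple of the monomial `m`, up to terms of lower degree. -/
def HasLead (m : ℤ →₀ ℕ) (p : MvPolynomial ℤ K) : Prop :=
  ∃ r : K, r ≠ 0 ∧ p - monomial m r ∈ lowDegree K m.degree

theorem HasLead.op [CharZero K] {m : ℤ →₀ ℕ} {p : MvPolynomial ℤ K} (h : HasLead m p) (b : K)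
    {n : ℤ} (hn : n ≠ 0) : HasLead (Finsupp.single n 1 + m) (op b n p) := by
  obtain ⟨r, hr, hp⟩ := h
  refine ⟨n * r, mul_ne_zero (Int.cast_ne_zero.2 hn) hr, ?_⟩
  have hdeg : (Finsupp.single n 1 + m).degree = m.degree + 1 := by
    rw [map_add, Finsupp.degree_single, add_comm]
  rw [hdeg]
  have h1 : (n : K) • X n * (p - monomial m r) ∈ lowDegree K (m.degree + 1) :=
    lowDegree_induction (f := LinearMap.mulLeft K ((n : K) • X n)) (fun m' hm' => by
      rw [LinearMap.mulLeft_apply, smul_mul_assoc]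
      exact Submodule.smul_mem _ _ (X_mul_monomial_mem hm' _ _)) hp
  have h2 : der b n (p - monomial m r) ∈ lowDegree K (m.degree + 1) :=
    lowDegree_induction (f := (der b n : MvPolynomial ℤ K →ₗ[K] MvPolynomial ℤ K)) (fun m' hm' =>
      lowDegree_mono (by omega) (der_monomial_mem b n m' 1)) hp
  have h3 := der_monomial_mem b n m r
  have h4 : monomial (Finsupp.single n 1 + m) (n * r) = (n : K) • X n * monomial m r := by
    rw [X, smul_mul_assoc, monomial_mul, smul_monomial, one_mul, smul_eq_mul]
  rw [op_apply, if_neg hn, zero_smul, add_zero, h4]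
  convert add_mem (add_mem h1 h2) h3 using 1
  rw [map_sub]
  ring

theorem HasLead.op_pow [CharZero K] {m : ℤ →₀ ℕ} {p : MvPolynomial ℤ K} (h : HasLead m p) (b : K)
    {n : ℤ} (hn : n ≠ 0) (a : ℕ) :
    HasLead (Finsupp.single n a + m) ((PolynomialRep.op b n ^ a) p) := by
  induction a with
  | zero => simpa using h
  | succ a ih =>
    rw [pow_succ', Module.End.mul_apply, add_comm a 1, Finsupp.single_add, add_assoc]
    exact ih.op b hn

theorem hasLead_prod [CharZero K] (b : K) {d : ℕ} (n : Fin d → ℤ) (hn : ∀ s, n s ≠ 0)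
    (a : Fin d → ℕ) :
    HasLead (∑ s, Finsupp.single (n s) (a s))
      ((List.ofFn fun s => PolynomialRep.op b (n s) ^ a s).prod 1) := by
  induction d with
  | zero => exact ⟨1, one_ne_zero, by simp⟩
  | succ d ih =>
    rw [Fin.sum_univ_succ, List.ofFn_succ, List.prod_cons, Module.End.mul_apply]
    exact (ih (fun s => n s.succ) (fun s => hn _) fun s => a s.succ).op_pow b (hn 0) _

/-- In a vanishing combination, choose an index `i` in the support with `m i` of maximal degree. No
other term can involve the monomial `m i`. -/
theorem linearIndependent_of_hasLead {ι : Type*} {m : ι → ℤ →₀ ℕ} (hm : Function.Injective m)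
    {p : ι → MvPolynomial ℤ K} (hp : ∀ i, HasLead (m i) (p i)) : LinearIndependent K p := by
  rw [linearIndependent_iff]
  intro g hg
  by_contra hne
  obtain ⟨i, hi, hmax⟩ := Finset.exists_max_image g.support (fun i => (m i).degree)
    (Finsupp.support_nonempty_iff.2 hne)
  have hcoeff := congrArg (coeff (m i)) hg
  rw [Finsupp.linearCombination_apply, Finsupp.sum, coeff_sum, coeff_zero,
    Finset.sum_eq_single i] at hcoeff
  · obtain ⟨r, hr, hlow⟩ := hp i
    have : coeff (m i) (p i) = r := by
      by_contra hc
      have hmem : m i ∈ (p i - monomial (m i) r).support := by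
        rw [mem_support_iff, coeff_sub, coeff_monomial, if_pos rfl]
        exact sub_ne_zero.2 hc
      exact absurd ((mem_restrictSupport_iff K).1 hlow hmem) (lt_irrefl (m i).degree)
    rw [coeff_smul, this, smul_eq_mul] at hcoeff
    exact (mul_ne_zero (Finsupp.mem_support_iff.1 hi) hr) hcoeff
  · intro j hj hji
    obtain ⟨r, hr, hlow⟩ := hp j
    rw [coeff_smul, smul_eq_mul]
    refine mul_eq_zero_of_right _ ?_
    by_contra hc
    have hmem : m i ∈ (p j - monomial (m j) r).support := by
      rw [mem_support_iff, coeff_sub, coeff_monomial, if_neg fun h => hji (hm h), sub_zero]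
      exact hc
    exact absurd ((mem_restrictSupport_iff K).1 hlow hmem) (not_lt.2 (hmax j hj))
  · intro h; exact absurd hi h

theorem linearIndependent_prod [CharZero K] (b : K) (d : ℕ) :
    LinearIndependent K fun a : Fin d → ℕ =>
      (List.ofFn fun s : Fin d => op b ((s : ℕ) + 1 : ℤ) ^ a s).prod := by
  refine LinearIndependent.of_comp (LinearMap.applyₗ (1 : MvPolynomial ℤ K)) ?_
  refine linearIndependent_of_hasLead (m := fun a : Fin d → ℕ =>
    ∑ s : Fin d, Finsupp.single ((s : ℕ) + 1 : ℤ) (a s)) ?_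
    fun a => hasLead_prod b _ (fun s => by omega) a
  intro a a' h
  funext t
  have := congrArg (fun f : ℤ →₀ ℕ => f ((t : ℕ) + 1)) h
  simpa [Finsupp.finsetSum_apply, Finsupp.single_apply, Fin.val_inj] using this

end PolynomialRep

/-! ### Infinite Gelfand–Kirillov dimension -/

theorem prod_ofFn_pow_mem {K A : Type*} [Field K] [Ring A] [Algebra K A] {d : ℕ} (x : Fin d → A)
    (a : Fin d → ℕ) (V : Submodule K A) (hx : ∀ s, x s ∈ V) (t : ℕ) (ha : ∀ s, a s ≤ t) :
    (List.ofFn fun s => x s ^ a s).prod ∈ (1 ⊔ V) ^ (d * t) := by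
  induction d with
  | zero => simp [Submodule.one_le.1 le_rfl]
  | succ d ih =>
    rw [List.ofFn_succ, List.prod_cons, add_mul, one_mul, add_comm (d * t) t, pow_add]
    refine Submodule.mul_mem_mul ?_ (ih (fun s => x s.succ) (fun s => a s.succ) (fun s => hx _)
      fun s => ha _)
    exact pow_le_pow_right₀ (show (1 : Submodule K A) ≤ 1 ⊔ V from le_sup_left) (ha 0)
      (Submodule.pow_mem_pow _ ((le_sup_right : V ≤ 1 ⊔ V) (hx 0)) _)

/-- Products with all exponents at most `n / d` lie in `(1 ⊔ V) ^ n`, and there are at least `(n /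
d) ^ d` of them. -/
theorem gkDim_eq_top {K A : Type*} [Field K] [Ring A] [Algebra K A]
    (h : ∀ d : ℕ, ∃ x : Fin d → A,
      LinearIndependent K fun a : Fin d → ℕ => (List.ofFn fun s => x s ^ a s).prod) :
    gkDim K A = ⊤ := by
  refine ENNReal.eq_top_of_forall_nnreal_le fun r => ?_
  -- For `n ≥ d ^ 2` one has `d * log (n / d) ≥ (d / 2) * log n`, which is at least `r * log n` for
  -- this `d`.
  obtain ⟨d, hd⟩ := exists_nat_ge (2 * (r : ℝ) + 1)
  have hd0 : (1 : ℝ) ≤ d := le_trans (by linarith [r.2]) hd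
  obtain ⟨x, hx⟩ := h d
  have hfg : (Submodule.span K (Set.range x)).FG := Submodule.fg_span (Set.finite_range x)
  refine le_trans ?_ (le_iSup₂ (f := fun (V : Submodule K A) (_ : V.FG) => Filter.limsup
      (fun n : ℕ => ENNReal.ofReal
        (Real.log (Module.finrank K ((1 ⊔ V) ^ n : Submodule K A)) / Real.log n))
      Filter.atTop) _ hfg)
  refine Filter.le_limsup_of_frequently_le (Filter.Eventually.frequently ?_)
  filter_upwards [Filter.eventually_ge_atTop (max 2 (d ^ 2))] with n hn
  have hn2 : 2 ≤ n := le_trans (le_max_left _ _) hn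
  have hnd : d ^ 2 ≤ n := le_trans (le_max_right _ _) hn
  set V := Submodule.span K (Set.range x)
  have hdim : (n / d + 1) ^ d ≤ Module.finrank K ((1 ⊔ V) ^ n : Submodule K A) := by
    -- Finiteness is essential: `finrank` would be `0` on an infinite-dimensional space.
    have hfin : Module.Finite K ((1 ⊔ V) ^ n : Submodule K A) :=
      Module.Finite.iff_fg.2 ((Submodule.FG.sup ⟨{1}, by simp [Submodule.one_eq_span]⟩ hfg).pow n)
    have hmem (a : Fin d → Fin (n / d + 1)) :
        (List.ofFn fun s => x s ^ (a s : ℕ)).prod ∈ (1 ⊔ V) ^ n :=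
      pow_le_pow_right₀ (show (1 : Submodule K A) ≤ 1 ⊔ V from le_sup_left)
        (Nat.mul_div_le n d)
        (prod_ofFn_pow_mem x (fun s => a s) V (fun s => Submodule.subset_span ⟨s, rfl⟩) _
          fun s => Nat.lt_succ_iff.1 (a s).2)
    have hli : LinearIndependent K fun a : Fin d → Fin (n / d + 1) =>
        (⟨_, hmem a⟩ : ((1 ⊔ V) ^ n : Submodule K A)) := by
      refine LinearIndependent.of_comp (Submodule.subtype _) ?_
      exact hx.comp (fun (a : Fin d → Fin (n / d + 1)) s => (a s : ℕ)) fun a a' haa => by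
        funext s; exact Fin.val_injective (congrFun haa s)
    simpa using hli.fintype_card_le_finrank
  have hlogn : 0 < Real.log n := Real.log_pos (by exact_mod_cast hn2)
  rw [← ENNReal.ofReal_coe_nnreal]
  refine ENNReal.ofReal_le_ofReal ?_
  rw [le_div_iff₀ hlogn]
  have hnd' : (n : ℝ) / d ≤ (n / d + 1 : ℕ) := by
    rw [div_le_iff₀ (by linarith)]
    have := Nat.lt_succ_iff.1 (Nat.lt_succ_of_lt (Nat.lt_mul_div_succ n (by
      exact_mod_cast (by linarith : (0 : ℝ) < d))))
    rw [mul_comm]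
    exact_mod_cast this
  have hnpos : (0 : ℝ) < n := by positivity
  have h1 : Real.log (((n : ℝ) / d) ^ d) ≤
      Real.log (Module.finrank K ((1 ⊔ V) ^ n : Submodule K A)) := by
    refine Real.log_le_log (by positivity) (le_trans (pow_le_pow_left₀ (by positivity) hnd' d) ?_)
    exact_mod_cast hdim
  refine le_trans ?_ h1
  rw [Real.log_pow, Real.log_div (by positivity) (by positivity)]
  have h2 : 2 * Real.log d ≤ Real.log n := by
    have := Real.log_le_log (by positivity) (show ((d : ℝ) ^ 2) ≤ n by exact_mod_cast hnd)
    rwa [Real.log_pow, Nat.cast_ofNat] at this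
  nlinarith [r.2]

/-! ### Pairing Laurent polynomials with functions -/

section Pairing

variable {K : Type*} [Field K] {G : Type*} {M : Type*} [AddCommGroup M] [Module K M]

/-- The value `∑ a(n) • φ n` of a Laurent polynomial `a` on a function `φ` of the exponents. -/
noncomputable def laurentPairing (φ : G → M) : AddMonoidAlgebra K G →ₗ[K] M :=
  (Finsupp.linearCombination K φ).comp
    (AddMonoidAlgebra.coeffLinearEquiv K : AddMonoidAlgebra K G ≃ₗ[K] (G →₀ K)).toLinearMap

theorem laurentPairing_apply (φ : G → M) (a : AddMonoidAlgebra K G) :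
    laurentPairing φ a = ∑ n ∈ a.coeff.support, a.coeff n • φ n := rfl

@[simp]
theorem laurentPairing_single (φ : G → M) (n : G) (r : K) :
    laurentPairing φ (AddMonoidAlgebra.single n r) = r • φ n :=
  Finsupp.linearCombination_single K r n

theorem laurentPairing_sub_left (φ ψ : G → M) (a : AddMonoidAlgebra K G) :
    laurentPairing (fun x => φ x - ψ x) a = laurentPairing φ a - laurentPairing ψ a := by
  simp only [laurentPairing_apply, smul_sub, Finset.sum_sub_distrib]

variable [AddCommGroup G]

theorem laurentPairing_single_mul (φ : G → M) (n : G) (a : AddMonoidAlgebra K G) :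
    laurentPairing φ (AddMonoidAlgebra.single n 1 * a) = laurentPairing (fun x => φ (n + x)) a := by
  induction a using AddMonoidAlgebra.induction_linear with
  | zero => simp
  | add x y hx hy => rw [mul_add, map_add, map_add, hx, hy]
  | single m r => rw [AddMonoidAlgebra.single_mul_single, laurentPairing_single,
      laurentPairing_single, one_mul]

/-- Multiplication by `1 - u ^ g` is transposed to the difference operator of step `g`; this turns
divisibility of `a` into vanishing of pairings. -/
theorem laurentPairing_one_sub_mul (φ : G → M) (g : G) (a : AddMonoidAlgebra K G) :
    laurentPairing φ ((1 - AddMonoidAlgebra.single g 1) * a) =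
      laurentPairing (fun n => φ n - φ (n + g)) a := by
  rw [sub_mul, one_mul, map_sub, laurentPairing_single_mul, laurentPairing_sub_left]
  simp only [add_comm g]

/-- The function `q` is annihilated by the `N`-th power of the difference operator of step `g`. -/
def IsPolynomialAlong (g : G) : ℕ → (G → K) → Prop
  | 0, q => ∀ n, q n = 0
  | N + 1, q => IsPolynomialAlong g N fun n => q n - q (n + g)

namespace IsPolynomialAlong

variable {g : G}

theorem add {N : ℕ} {p q : G → K} (hp : IsPolynomialAlong g N p) (hq : IsPolynomialAlong g N q) :
    IsPolynomialAlong g N fun n => p n + q n := by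
  induction N generalizing p q with
  | zero => intro n; simp [hp n, hq n]
  | succ N ih =>
    have := ih hp hq
    unfold IsPolynomialAlong
    convert this using 2
    ring

theorem const_mul_shift {N : ℕ} {p : G → K} (hp : IsPolynomialAlong g N p) (c : K) :
    IsPolynomialAlong g N fun n => c * p (n + g) := by
  induction N generalizing p with
  | zero => intro n; simp [hp (n + g)]
  | succ N ih =>
    have := ih hp
    unfold IsPolynomialAlong
    convert this using 2
    ring

/-- Discrete Leibniz rule: the difference of `t * p` is `t` times the difference of `p`, minus `c`
times a shift of `p`. -/
theorem affine_mul {N : ℕ} {p t : G → K} {c : K} (ht : ∀ n, t (n + g) = t n + c)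
    (hp : IsPolynomialAlong g N p) : IsPolynomialAlong g (N + 1) fun n => t n * p n := by
  induction N generalizing p with
  | zero => intro n; simp [hp n, hp (n + g)]
  | succ N ih =>
    have : IsPolynomialAlong g (N + 1)
        fun n => t n * (p n - p (n + g)) + -c * p (n + g) := (ih hp).add (hp.const_mul_shift (-c))
    change IsPolynomialAlong g (N + 1) fun n => t n * p n - t (n + g) * p (n + g)
    convert this using 2 with n
    rw [ht]
    ring

theorem prod {ι : Type*} (S : Finset ι) (t : ι → G → K) (ht : ∀ i, ∃ c, ∀ n, t i (n + g) = t i n + c) :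
    IsPolynomialAlong g (S.card + 1) fun n => ∏ i ∈ S, t i n := by
  classical
  induction S using Finset.induction_on with
  | empty => intro n; simp
  | insert i S hi ih =>
    obtain ⟨c, hc⟩ := ht i
    simp only [Finset.prod_insert hi, Finset.card_insert_of_notMem hi]
    exact affine_mul hc ih

theorem laurentPairing_eq_zero {N : ℕ} {q : G → K} (hq : IsPolynomialAlong g N q) {h : G → M}
    (hh : ∀ n, h (n + g) = h n) (a : AddMonoidAlgebra K G) :
    laurentPairing (fun n => q n • h n) ((1 - AddMonoidAlgebra.single g 1) ^ N * a) = 0 := by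
  induction N generalizing q with
  | zero => rw [laurentPairing_apply]; exact Finset.sum_eq_zero fun n _ => by simp [hq n]
  | succ N ih =>
    rw [pow_succ', mul_assoc, laurentPairing_one_sub_mul]
    simp only [hh, ← sub_smul]
    exact ih hq

end IsPolynomialAlong

end Pairing

/-! ### Orders on integer vectors -/

section Key

variable {k : ℕ}

/-- A vector of integers is compared through a weighted sum first, lexicographically second. -/
def weightedLex (ε δ : Fin k → ℤ) : ℤ ×ₗ Lex (Fin k → ℤ) := toLex (∑ s, ε s * δ s, toLex δ)

theorem weightedLex_add (ε δ δ' : Fin k → ℤ) :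
    weightedLex ε (δ + δ') = weightedLex ε δ + weightedLex ε δ' := by
  simp [weightedLex, mul_add, Finset.sum_add_distrib, ← toLex_add]

theorem weightedLex_sub (ε δ δ' : Fin k → ℤ) :
    weightedLex ε (δ - δ') = weightedLex ε δ - weightedLex ε δ' := by
  rw [eq_sub_iff_add_eq, ← weightedLex_add, sub_add_cancel]

theorem weightedLex_injective (ε : Fin k → ℤ) : Function.Injective (weightedLex ε) :=
  fun _ _ h => toLex.injective (congrArg (fun x => (ofLex x).2) h)

theorem weightedLex_neg_iff (ε δ : Fin k → ℤ) : weightedLex ε δ < 0 ↔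
    ∑ s, ε s * δ s < 0 ∨ ∑ s, ε s * δ s = 0 ∧ ∃ r, (∀ s < r, δ s = 0) ∧ δ r < 0 := by
  rw [weightedLex, ← toLex_zero, Prod.Lex.toLex_lt_toLex]
  rfl

/-- This fixes the choice of order: the ratio `u s' / u s` is negative simultaneously for all
antitone weights, the tie `ε s = ε s'` being broken by the entry `-1` at `s`. -/
theorem weightedLex_single_sub_single_neg {ε : Fin k → ℤ} (hε : Antitone ε) {s s' : Fin k}
    (h : s < s') : weightedLex ε (Pi.single s' 1 - Pi.single s 1) < 0 := by
  have hsum : ∑ t, ε t * (Pi.single s' 1 - Pi.single s 1 : Fin k → ℤ) t = ε s' - ε s := by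
    simp [mul_sub, Finset.sum_sub_distrib, Pi.single_apply]
  rw [weightedLex_neg_iff, hsum]
  rcases (hε h.le).lt_or_eq with h' | h'
  · left; omega
  · refine Or.inr ⟨by omega, s, fun t ht => ?_, ?_⟩
    · simp [ht.ne, (ht.trans h).ne]
    · simp [h.ne]

variable {K : Type*} [Field K]

/-- The Laurent polynomials all of whose exponents are negative. -/
def negativeExponents (K : Type*) [Field K] (k : ℕ) :
    Submodule K (AddMonoidAlgebra K (Fin k → ℤ)) where
  carrier := {b | ∀ ρ, b.coeff ρ ≠ 0 → ∀ ε : Fin k → ℤ, Antitone ε → weightedLex ε ρ < 0}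
  add_mem' {a b} ha hb ρ h ε hε := by
    by_cases h' : a.coeff ρ = 0
    · exact hb ρ (by intro h0; apply h; simp [h', h0]) ε hε
    · exact ha ρ h' ε hε
  zero_mem' ρ h := by simp at h
  smul_mem' r b hb ρ h ε hε := hb ρ (by intro h0; apply h; simp [h0]) ε hε

theorem mul_mem_negativeExponents {a b : AddMonoidAlgebra K (Fin k → ℤ)}
    (ha : a ∈ negativeExponents K k) (hb : b ∈ negativeExponents K k) :
    a * b ∈ negativeExponents K k := by
  classical
  intro ρ h ε hε
  have := AddMonoidAlgebra.support_coeff_mul_subset a b (Finsupp.mem_support_iff.2 h)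
  obtain ⟨x, hx, y, hy, rfl⟩ := Finset.mem_add.1 this
  rw [weightedLex_add]
  exact add_neg (ha x (Finsupp.mem_support_iff.1 hx) ε hε) (hb y (Finsupp.mem_support_iff.1 hy) ε hε)

/-- Elements of the form `1 +` (negative exponents) are closed under products, so the leading term
`1` survives in the product of all the factors. -/
theorem mul_sub_one_mem {a b : AddMonoidAlgebra K (Fin k → ℤ)}
    (ha : a - 1 ∈ negativeExponents K k) (hb : b - 1 ∈ negativeExponents K k) :
    a * b - 1 ∈ negativeExponents K k := by
  have : a * b - 1 = (a - 1) * (b - 1) + (a - 1) + (b - 1) := by ring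
  rw [this]
  exact add_mem (add_mem (mul_mem_negativeExponents ha hb) ha) hb

/-- The Laurent polynomial `1 - u s' / u s`. -/
noncomputable def oneSubRatio (K : Type*) [Field K] (p : Fin k × Fin k) :
    AddMonoidAlgebra K (Fin k → ℤ) :=
  1 - AddMonoidAlgebra.single (Pi.single p.2 1 - Pi.single p.1 1) 1

theorem oneSubRatio_sub_one_mem {p : Fin k × Fin k} (h : p.1 < p.2) :
    oneSubRatio K p - 1 ∈ negativeExponents K k := by
  rw [oneSubRatio, sub_sub_cancel_left]
  refine neg_mem fun ρ hρ ε hε => ?_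
  rw [AddMonoidAlgebra.coeff_single, Finsupp.single_apply] at hρ
  split_ifs at hρ with h'
  · rw [← h']; exact weightedLex_single_sub_single_neg hε h
  · exact absurd rfl hρ

theorem pow_sub_one_mem {a : AddMonoidAlgebra K (Fin k → ℤ)}
    (ha : a - 1 ∈ negativeExponents K k) (N : ℕ) : a ^ N - 1 ∈ negativeExponents K k := by
  induction N with
  | zero => simp
  | succ N ih => rw [pow_succ]; exact mul_sub_one_mem ih ha

theorem exists_oneSubRatio_pow_dvd (K : Type*) [Field K] (k : ℕ) :
    ∃ a : AddMonoidAlgebra K (Fin k → ℤ), a - 1 ∈ negativeExponents K k ∧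
      ∀ p : Fin k × Fin k, p.1 < p.2 → oneSubRatio K p ^ (k + 1) ∣ a := by
  refine ⟨∏ p ∈ (Finset.univ : Finset (Fin k × Fin k)).filter (fun p => p.1 < p.2),
    oneSubRatio K p ^ (k + 1), ?_, fun p hp => ?_⟩
  · refine Finset.prod_induction _ (fun a => a - 1 ∈ negativeExponents K k)
      (fun a b => mul_sub_one_mem) ?_ fun p hp =>
        pow_sub_one_mem (oneSubRatio_sub_one_mem (Finset.mem_filter.1 hp).2) _
    rw [sub_self]; exact zero_mem _
  · exact Finset.dvd_prod_of_mem (fun p => oneSubRatio K p ^ (k + 1))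
      (Finset.mem_filter.2 ⟨Finset.mem_univ p, hp⟩)

/-- Pairing with a multiple of a high power of every `1 - u s' / u s` annihilates the functions
that depend on two of the exponents only through their sum, up to polynomial factors. -/
theorem laurentPairing_eq_zero_of_invariant {M : Type*} [AddCommGroup M] [Module K M]
    {a : AddMonoidAlgebra K (Fin k → ℤ)}
    (ha : ∀ p : Fin k × Fin k, p.1 < p.2 → oneSubRatio K p ^ (k + 1) ∣ a)
    {t : Fin k → (Fin k → ℤ) → K} (ht : ∀ s g, ∃ c, ∀ n, t s (n + g) = t s n + c)
    {h : (Fin k → ℤ) → M} {s s' : Fin k} (hs : s < s')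
    (hh : ∀ n, h (n + (Pi.single s' 1 - Pi.single s 1)) = h n) (n₀ : Fin k → ℤ) :
    laurentPairing (fun n => (∏ s, t s n) • h n) (AddMonoidAlgebra.single n₀ 1 * a) = 0 := by
  obtain ⟨b, hb⟩ := ha (s, s') hs
  rw [hb, mul_left_comm]
  refine IsPolynomialAlong.laurentPairing_eq_zero ?_ hh _
  -- A product of `k` affine factors has degree at most `k` along the direction, hence the exponent
  -- `k + 1`.
  simpa using IsPolynomialAlong.prod Finset.univ t (fun i => ht i _)

end Key

/-! ### The filtration of an algebra with Witt type relations -/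

/-- The elements `e i`, `i ∈ Λ`, satisfy the relations of the Witt algebra up to scalars. -/
structure WittRelations {K B : Type*} [Field K] [Ring B] [Algebra K B] (Λ : Set ℤ) (θ : ℤ → ℤ → K)
    (e : ℤ → B) : Prop where
  add_closed : ∀ i ∈ Λ, ∀ j ∈ Λ, i + j ∈ Λ
  commutator : ∀ i ∈ Λ, ∀ j ∈ Λ,
    e i * e j - e j * e i = ((j : K) - i) • e (i + j) + algebraMap K B (θ i j)

/-- The sum of the absolute values of the entries of a list. -/
def absSum (l : List ℤ) : ℕ := (l.map Int.natAbs).sum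

@[simp] theorem absSum_nil : absSum [] = 0 := rfl

@[simp] theorem absSum_cons (i : ℤ) (l : List ℤ) : absSum (i :: l) = i.natAbs + absSum l := by
  simp [absSum]

@[simp] theorem absSum_append (l l' : List ℤ) : absSum (l ++ l') = absSum l + absSum l' := by
  simp [absSum]

theorem absSum_ofFn {k : ℕ} (v : Fin k → ℤ) : absSum (List.ofFn v) = ∑ s, (v s).natAbs := by
  simp [absSum, List.map_ofFn, List.sum_ofFn]

theorem List.Perm.absSum_eq {l l' : List ℤ} (h : l.Perm l') : absSum l = absSum l' :=
  (h.map _).sum_eq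

section Filtration

variable (K : Type*) {B : Type*} [Field K] [Ring B] [Algebra K B] (Λ : Set ℤ) (e : ℤ → B)

/-- The span of the products of fewer than `d` factors `e i`, `i ∈ Λ`, with `∑ |i| ≤ w`. -/
def wordSpan (d w : ℕ) : Submodule K B :=
  Submodule.span K {x | ∃ l : List ℤ, (∀ i ∈ l, i ∈ Λ) ∧ l.length < d ∧ absSum l ≤ w ∧
    (l.map e).prod = x}

variable {K Λ e}

theorem prod_mem_wordSpan {d w : ℕ} {l : List ℤ} (hl : ∀ i ∈ l, i ∈ Λ) (hd : l.length < d)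
    (hw : absSum l ≤ w) : (l.map e).prod ∈ wordSpan K Λ e d w :=
  Submodule.subset_span ⟨l, hl, hd, hw, rfl⟩

theorem wordSpan_mono {d d' w w' : ℕ} (hd : d ≤ d') (hw : w ≤ w') :
    wordSpan K Λ e d w ≤ wordSpan K Λ e d' w' :=
  Submodule.span_mono fun _ ⟨l, h1, h2, h3, h4⟩ => ⟨l, h1, h2.trans_le hd, h3.trans hw, h4⟩

theorem wordSpan_induction {d w : ℕ} {S : Submodule K B} {f : B →ₗ[K] B}
    (h : ∀ l : List ℤ, (∀ i ∈ l, i ∈ Λ) → l.length < d → absSum l ≤ w → f (l.map e).prod ∈ S)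
    {x : B} (hx : x ∈ wordSpan K Λ e d w) : f x ∈ S :=
  (Submodule.span_le (p := S.comap f)).2
    (by rintro _ ⟨l, h1, h2, h3, rfl⟩; exact h l h1 h2 h3) hx

theorem prod_mul_mem_wordSpan {d w : ℕ} {l : List ℤ} (hl : ∀ i ∈ l, i ∈ Λ) {x : B}
    (hx : x ∈ wordSpan K Λ e d w) :
    (l.map e).prod * x ∈ wordSpan K Λ e (d + l.length) (w + absSum l) :=
  wordSpan_induction (f := LinearMap.mulLeft K (l.map e).prod) (fun l' h1 h2 h3 => by
    rw [LinearMap.mulLeft_apply, ← List.prod_append, ← List.map_append]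
    refine prod_mem_wordSpan (fun i hi => ?_) ?_ ?_
    · exact (List.mem_append.1 hi).elim (hl i) (h1 i)
    · rw [List.length_append]; omega
    · rw [absSum_append]; omega) hx

theorem mul_prod_mem_wordSpan {d w : ℕ} {l : List ℤ} (hl : ∀ i ∈ l, i ∈ Λ) {x : B}
    (hx : x ∈ wordSpan K Λ e d w) :
    x * (l.map e).prod ∈ wordSpan K Λ e (d + l.length) (w + absSum l) :=
  wordSpan_induction (f := LinearMap.mulRight K (l.map e).prod) (fun l' h1 h2 h3 => by
    rw [LinearMap.mulRight_apply, ← List.prod_append, ← List.map_append]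
    refine prod_mem_wordSpan (fun i hi => ?_) ?_ ?_
    · exact (List.mem_append.1 hi).elim (h1 i) (hl i)
    · rw [List.length_append]; omega
    · rw [absSum_append]; omega) hx

theorem e_mul_mem_wordSpan {d w : ℕ} {i : ℤ} (hi : i ∈ Λ) {x : B}
    (hx : x ∈ wordSpan K Λ e d w) : e i * x ∈ wordSpan K Λ e (d + 1) (w + i.natAbs) := by
  simpa using prod_mul_mem_wordSpan (l := [i]) (by simpa using hi) hx

namespace WittRelations

variable {θ : ℤ → ℤ → K}

theorem commutator_mul_mem (H : WittRelations Λ θ e) {i j : ℤ} (hi : i ∈ Λ) (hj : j ∈ Λ)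
    {l : List ℤ} (hl : ∀ i ∈ l, i ∈ Λ) {w : ℕ} (hw : i.natAbs + j.natAbs + absSum l ≤ w) :
    (e i * e j - e j * e i) * (l.map e).prod ∈ wordSpan K Λ e (l.length + 2) w := by
  rw [H.commutator i hi j hj, add_mul, smul_mul_assoc, ← Algebra.smul_def]
  refine add_mem (Submodule.smul_mem _ _ ?_) (Submodule.smul_mem _ _
    (prod_mem_wordSpan hl (by omega) (by omega)))
  have : (((i + j) :: l).map e).prod ∈ wordSpan K Λ e (l.length + 2) w := by
    refine prod_mem_wordSpan ?_ (by simp) ?_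
    · simpa using ⟨H.add_closed i hi j hj, hl⟩
    · rw [absSum_cons]; have := Int.natAbs_add_le i j; omega
  simpa using this

/-- A transposition replaces two letters by the single letter `i + j` or by a scalar. Either way the
word gets shorter and `∑ |i|` does not grow. -/
theorem prod_sub_prod_mem_of_perm (H : WittRelations Λ θ e) {l l' : List ℤ} (h : l.Perm l')
    (hl : ∀ i ∈ l, i ∈ Λ) :
    (l.map e).prod - (l'.map e).prod ∈ wordSpan K Λ e l.length (absSum l) := by
  induction h with
  | nil => simp
  | cons i h ih =>
    simp only [List.mem_cons, forall_eq_or_imp] at hl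
    have := e_mul_mem_wordSpan hl.1 (ih hl.2)
    rw [mul_sub] at this
    simpa [add_comm] using this
  | swap i j l =>
    simp only [List.mem_cons, forall_eq_or_imp] at hl
    have := H.commutator_mul_mem hl.1 hl.2.1 hl.2.2 le_rfl
    simp only [List.map_cons, List.prod_cons, List.length_cons, absSum_cons]
    rw [sub_mul, mul_assoc, mul_assoc, add_assoc] at this
    exact this
  | trans h1 h2 ih1 ih2 =>
    rw [← h1.length_eq, ← h1.absSum_eq] at ih2
    have := add_mem (ih1 hl) (ih2 fun i hi => hl i (h1.mem_iff.2 hi))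
    simpa using this

theorem commutator_prod_mem (H : WittRelations Λ θ e) {n : ℤ} (hn : n ∈ Λ) {l : List ℤ}
    (hl : ∀ i ∈ l, i ∈ Λ) :
    e n * (l.map e).prod - (l.map e).prod * e n ∈
      wordSpan K Λ e (l.length + 1) (absSum l + n.natAbs) := by
  have h := H.prod_sub_prod_mem_of_perm (l := n :: l) (l' := l ++ [n])
    (List.perm_append_singleton n l).symm (by simpa using ⟨hn, hl⟩)
  simpa [add_comm] using h

theorem commutator_mem (H : WittRelations Λ θ e) {n : ℤ} (hn : n ∈ Λ) {d w : ℕ} {x : B}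
    (hx : x ∈ wordSpan K Λ e d w) :
    e n * x - x * e n ∈ wordSpan K Λ e d (w + n.natAbs) :=
  wordSpan_induction (f := LinearMap.mulLeft K (e n) - LinearMap.mulRight K (e n))
    (fun l h1 h2 h3 => wordSpan_mono (by omega) (by omega) (H.commutator_prod_mem hn h1)) hx

end WittRelations

/-- The product `e (v 0) * e (v 1) * ⋯`. -/
def word (e : ℤ → B) {k : ℕ} (v : Fin k → ℤ) : B := ((List.ofFn v).map e).prod

theorem word_succ {k : ℕ} (v : Fin (k + 1) → ℤ) :
    word e v = e (v 0) * word e fun s => v s.succ := by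
  simp [word, List.ofFn_succ]

theorem word_mem_wordSpan {k : ℕ} {v : Fin k → ℤ} (hv : ∀ s, v s ∈ Λ) {d w : ℕ} (hd : k < d)
    (hw : ∑ s, (v s).natAbs ≤ w) : word e v ∈ wordSpan K Λ e d w :=
  prod_mem_wordSpan (by simpa [List.mem_ofFn] using hv) (by simpa using hd)
    (by rwa [absSum_ofFn])

/-! ### Commutators of generators with words, modulo shorter words -/

namespace WittRelations

variable {θ : ℤ → ℤ → K}

theorem commutator_word_sub_mem (H : WittRelations Λ θ e) {n : ℤ} (hn : n ∈ Λ) {k : ℕ}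
    {v : Fin k → ℤ} (hv : ∀ s, v s ∈ Λ) :
    e n * word e v - word e v * e n - ∑ r, ((v r - n : ℤ) : K) • word e (v + Pi.single r n) ∈
      wordSpan K Λ e k (∑ s, (v s).natAbs + n.natAbs) := by
  induction k with
  | zero => simp [word]
  | succ k ih =>
    have h1 := e_mul_mem_wordSpan (hv 0) (ih fun s => hv s.succ)
    have h2 : algebraMap K B (θ n (v 0)) * word e (fun s => v s.succ) ∈
        wordSpan K Λ e (k + 1) (∑ s, (v s).natAbs + n.natAbs) := by
      rw [← Algebra.smul_def]
      refine Submodule.smul_mem _ _ (word_mem_wordSpan (fun s => hv _) (by omega) ?_)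
      rw [Fin.sum_univ_succ]; omega
    have hw : ∑ s : Fin k, (v s.succ).natAbs + n.natAbs + (v 0).natAbs =
        ∑ s, (v s).natAbs + n.natAbs := by
      rw [Fin.sum_univ_succ (f := fun s => (v s).natAbs)]; omega
    rw [hw] at h1
    convert add_mem h1 h2 using 1
    rw [Fin.sum_univ_succ, word_succ v]
    have h3 : word e (v + Pi.single 0 n) = e (n + v 0) * word e fun s => v s.succ := by
      rw [word_succ]; simp [add_comm]
    have h4 (r : Fin k) : word e (v + Pi.single r.succ n) =
        e (v 0) * word e ((fun s => v s.succ) + Pi.single r n) := by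
      rw [word_succ]
      congr 2
      · simp
      · funext s; simp [Pi.single_apply]
    have h5 := H.commutator n hn (v 0) (hv 0)
    rw [sub_eq_iff_eq_add] at h5
    simp only [h3, h4, mul_sub, Finset.mul_sum, mul_smul_comm, ← mul_assoc, h5, add_mul,
      smul_mul_assoc, Int.cast_sub]
    abel

end WittRelations

/-- The iterated commutator with `e (n 0)`, `e (n 1)`, …, the last one being applied first. -/
def iterCommutator (e : ℤ → B) {m : ℕ} (n : Fin m → ℤ) (x : B) : B :=
  (List.ofFn n).foldr (fun i y => e i * y - y * e i) x

theorem iterCommutator_succ {m : ℕ} (n : Fin (m + 1) → ℤ) (x : B) :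
    iterCommutator e n x = e (n 0) * iterCommutator e (fun s => n s.succ) x -
      iterCommutator e (fun s => n s.succ) x * e (n 0) := by
  simp [iterCommutator, List.ofFn_succ]

theorem iterCommutator_sum {m : ℕ} (n : Fin m → ℤ) {ι : Type*} (S : Finset ι) (c : ι → K)
    (x : ι → B) :
    iterCommutator e n (∑ i ∈ S, c i • x i) = ∑ i ∈ S, c i • iterCommutator e n (x i) := by
  induction m with
  | zero => simp [iterCommutator]
  | succ m ih =>
    simp only [iterCommutator_succ, ih, Finset.mul_sum, Finset.sum_mul, mul_smul_comm,
      smul_mul_assoc, smul_sub, Finset.sum_sub_distrib]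

/-- The vector with entries `∑ n s`, the sum over the fibres of `σ`. -/
def fibreSum {m k : ℕ} (σ : Fin m → Fin k) (n : Fin m → ℤ) : Fin k → ℤ :=
  fun r => ∑ s, if σ s = r then n s else 0

/-- The coefficient of `word e (v + fibreSum σ n)` in the iterated commutator of `word e v`. -/
def commutatorCoeff {m k : ℕ} (σ : Fin m → Fin k) (v : Fin k → ℤ) (n : Fin m → ℤ) : ℤ :=
  ∏ s, (v (σ s) + (∑ s', if s < s' ∧ σ s' = σ s then n s' else 0) - n s)

theorem fibreSum_cons {m k : ℕ} (r : Fin k) (σ : Fin m → Fin k) (n : Fin (m + 1) → ℤ) :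
    fibreSum (Fin.cons r σ : Fin (m + 1) → Fin k) n =
      fibreSum σ (fun s => n s.succ) + Pi.single r (n 0) := by
  funext t
  simp [fibreSum, Fin.sum_univ_succ, Pi.single_apply, add_comm, eq_comm]

theorem commutatorCoeff_cons {m k : ℕ} (r : Fin k) (σ : Fin m → Fin k) (v : Fin k → ℤ)
    (n : Fin (m + 1) → ℤ) :
    commutatorCoeff (Fin.cons r σ : Fin (m + 1) → Fin k) v n =
      ((v + fibreSum σ fun s => n s.succ) r - n 0) *
        commutatorCoeff σ v (fun s => n s.succ) := by
  simp [commutatorCoeff, fibreSum, Fin.prod_univ_succ, Fin.sum_univ_succ]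

theorem add_single_apply {k : ℕ} (v : Fin k → ℤ) (r t : Fin k) (n : ℤ) :
    (v + Pi.single r n : Fin k → ℤ) t = v t + if t = r then n else 0 := by
  simp [Pi.single_apply]

theorem sum_natAbs_add_fibreSum_le {m k : ℕ} (σ : Fin m → Fin k) (v : Fin k → ℤ)
    (n : Fin m → ℤ) : ∑ r, ((v + fibreSum σ n) r).natAbs ≤
      ∑ r, (v r).natAbs + ∑ s, (n s).natAbs := by
  induction m with
  | zero => simp [fibreSum]
  | succ m ih =>
    obtain ⟨r, τ, rfl⟩ : ∃ r τ, σ = Fin.cons r τ := ⟨σ 0, Fin.tail σ, (Fin.cons_self_tail σ).symm⟩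
    rw [fibreSum_cons, ← add_assoc, Fin.sum_univ_succ (f := fun s => (n s).natAbs)]
    have h1 := ih τ fun s => n s.succ
    have h2 : ∑ t, ((v + fibreSum τ (fun s => n s.succ) + Pi.single r (n 0) : Fin k → ℤ) t).natAbs ≤
        ∑ t, (((v + fibreSum τ fun s => n s.succ) t).natAbs +
          if t = r then (n 0).natAbs else 0) := by
      refine Finset.sum_le_sum fun t _ => ?_
      rw [add_single_apply]
      split_ifs
      · exact Int.natAbs_add_le _ _
      · simp
    rw [Finset.sum_add_distrib] at h2
    simp only [Finset.sum_ite_eq', Finset.mem_univ, if_true] at h2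
    omega

namespace WittRelations

variable {θ : ℤ → ℤ → K}

theorem add_fibreSum_mem (H : WittRelations Λ θ e) {m k : ℕ} (σ : Fin m → Fin k) {v : Fin k → ℤ}
    (hv : ∀ s, v s ∈ Λ) {n : Fin m → ℤ} (hn : ∀ s, n s ∈ Λ) (r : Fin k) :
    (v + fibreSum σ n) r ∈ Λ := by
  induction m generalizing r with
  | zero => simpa [fibreSum] using hv r
  | succ m ih =>
    obtain ⟨t, τ, rfl⟩ : ∃ r τ, σ = Fin.cons r τ := ⟨σ 0, Fin.tail σ, (Fin.cons_self_tail σ).symm⟩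
    rw [fibreSum_cons, ← add_assoc, add_single_apply]
    have := ih τ (fun s => hn s.succ) r
    split_ifs
    · exact H.add_closed _ this _ (hn 0)
    · rwa [add_zero]

theorem iterCommutator_mem (H : WittRelations Λ θ e) {m : ℕ} {n : Fin m → ℤ} (hn : ∀ s, n s ∈ Λ)
    {d w : ℕ} {x : B} (hx : x ∈ wordSpan K Λ e d w) :
    iterCommutator e n x ∈ wordSpan K Λ e d (w + ∑ s, (n s).natAbs) := by
  induction m with
  | zero => simpa [iterCommutator] using hx
  | succ m ih =>
    rw [iterCommutator_succ]
    refine wordSpan_mono le_rfl ?_ (H.commutator_mem (hn 0) (ih fun s => hn s.succ))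
    rw [Fin.sum_univ_succ]; omega

/-- Each commutator acts by the Leibniz rule, and `σ s` is the letter that absorbs `n s`. Letters
hit earlier have already moved, which explains the partial fibre sums over `s' > s` in
`commutatorCoeff`. -/
theorem iterCommutator_word_sub_mem (H : WittRelations Λ θ e) {m k : ℕ} {n : Fin m → ℤ}
    (hn : ∀ s, n s ∈ Λ) {v : Fin k → ℤ} (hv : ∀ s, v s ∈ Λ) :
    iterCommutator e n (word e v) -
        ∑ σ : Fin m → Fin k, (commutatorCoeff σ v n : K) • word e (v + fibreSum σ n) ∈
      wordSpan K Λ e k (∑ s, (v s).natAbs + ∑ s, (n s).natAbs) := by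
  induction m with
  | zero =>
    have : v + fibreSum (default : Fin 0 → Fin k) n = v := by
      funext r; simp [fibreSum]
    simp [iterCommutator, commutatorCoeff, this]
  | succ m ih =>
    set n' : Fin m → ℤ := fun s => n s.succ with hn'
    have hw : ∑ s, (v s).natAbs + ∑ s, (n' s).natAbs + (n 0).natAbs =
        ∑ s, (v s).natAbs + ∑ s, (n s).natAbs := by
      rw [Fin.sum_univ_succ (f := fun s => (n s).natAbs)]; simp only [hn']; omega
    have h1 := H.commutator_mem (hn 0) (ih fun s => hn s.succ)
    have h2 : ∑ σ : Fin m → Fin k, (commutatorCoeff σ v n' : K) •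
        (e (n 0) * word e (v + fibreSum σ n') - word e (v + fibreSum σ n') * e (n 0) -
          ∑ r, (((v + fibreSum σ n') r - n 0 : ℤ) : K) •
            word e (v + fibreSum σ n' + Pi.single r (n 0))) ∈
        wordSpan K Λ e k (∑ s, (v s).natAbs + ∑ s, (n' s).natAbs + (n 0).natAbs) := by
      refine Submodule.sum_mem _ fun σ _ => Submodule.smul_mem _ _ ?_
      refine wordSpan_mono le_rfl ?_ (H.commutator_word_sub_mem (hn 0)
        (H.add_fibreSum_mem σ hv fun s => hn s.succ))
      have := sum_natAbs_add_fibreSum_le σ v n'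
      omega
    have h3 : ∑ σ : Fin (m + 1) → Fin k, (commutatorCoeff σ v n : K) • word e (v + fibreSum σ n) =
        ∑ σ : Fin m → Fin k, (commutatorCoeff σ v n' : K) •
          ∑ r, (((v + fibreSum σ n') r - n 0 : ℤ) : K) •
            word e (v + fibreSum σ n' + Pi.single r (n 0)) := by
      rw [← (Fin.consEquiv fun _ => Fin k).sum_comp, Fintype.sum_prod_type_right]
      refine Finset.sum_congr rfl fun σ _ => ?_
      rw [Finset.smul_sum]
      refine Finset.sum_congr rfl fun r _ => ?_
      change (commutatorCoeff (Fin.cons r σ : Fin (m + 1) → Fin k) v n : K) •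
        word e (v + fibreSum (Fin.cons r σ : Fin (m + 1) → Fin k) n) = _
      rw [commutatorCoeff_cons, fibreSum_cons, smul_smul, ← add_assoc, Int.cast_mul, mul_comm]
    rw [← hw]
    convert add_mem h1 h2 using 1
    rw [iterCommutator_succ, h3]
    simp only [← hn', smul_sub, Finset.sum_sub_distrib, mul_sub, sub_mul, Finset.mul_sum,
      Finset.sum_mul, mul_smul_comm, smul_mul_assoc]
    abel

end WittRelations

end Filtration

/-! ### Leading terms of relations -/

section PairingLinear

variable {K : Type*} [Field K] {G : Type*} {M : Type*} [AddCommGroup M] [Module K M]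

theorem laurentPairing_smul_left (c : K) (φ : G → M) (a : AddMonoidAlgebra K G) :
    laurentPairing (fun x => c • φ x) a = c • laurentPairing φ a := by
  simp only [laurentPairing_apply, Finset.smul_sum, smul_comm c]

theorem laurentPairing_sum_left {ι : Type*} (S : Finset ι) (φ : ι → G → M)
    (a : AddMonoidAlgebra K G) :
    laurentPairing (fun x => ∑ i ∈ S, φ i x) a = ∑ i ∈ S, laurentPairing (φ i) a := by
  simp only [laurentPairing_apply, Finset.smul_sum]
  exact Finset.sum_comm

theorem laurentPairing_mem {φ : G → M} {a : AddMonoidAlgebra K G} {S : Submodule K M}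
    (h : ∀ n ∈ a.coeff.support, φ n ∈ S) : laurentPairing φ a ∈ S :=
  Submodule.sum_mem _ fun n hn => S.smul_mem _ (h n hn)

end PairingLinear

theorem fibreSum_add {m k : ℕ} (σ : Fin m → Fin k) (n n' : Fin m → ℤ) :
    fibreSum σ (n + n') = fibreSum σ n + fibreSum σ n' := by
  funext r
  simp only [fibreSum, Pi.add_apply, ← Finset.sum_add_distrib]
  exact Finset.sum_congr rfl fun s _ => by split_ifs <;> simp

theorem fibreSum_single_sub_single {m k : ℕ} {σ : Fin m → Fin k} {s s' : Fin m}
    (h : σ s = σ s') : fibreSum σ (Pi.single s' 1 - Pi.single s 1) = 0 := by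
  funext r
  have (t : Fin m) : (if σ t = r then (Pi.single s' 1 - Pi.single s 1 : Fin m → ℤ) t else 0) =
      (if t = s' then (if σ s' = r then 1 else 0) else 0) -
        if t = s then (if σ s = r then 1 else 0) else 0 := by
    by_cases h1 : t = s' <;> by_cases h2 : t = s <;> simp [Pi.single_apply, h1, h2] <;> grind
  simp only [fibreSum, this, Finset.sum_sub_distrib, Finset.sum_ite_eq', Finset.mem_univ, if_true, h]
  simp

theorem fibreSum_apply_of_injective {m k : ℕ} {σ : Fin m → Fin k} (h : Function.Injective σ)
    (n : Fin m → ℤ) (s : Fin m) : fibreSum σ n (σ s) = n s := by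
  simp [fibreSum, h.eq_iff]

theorem commutatorCoeff_of_injective {m k : ℕ} {σ : Fin m → Fin k} (h : Function.Injective σ)
    (v : Fin k → ℤ) (n : Fin m → ℤ) : commutatorCoeff σ v n = ∏ s, (v (σ s) - n s) := by
  refine Finset.prod_congr rfl fun s _ => ?_
  rw [Finset.sum_eq_zero, add_zero]
  intro s' _
  rw [if_neg]
  rintro ⟨h1, h2⟩
  exact h1.ne' (h h2)

/-! ### From one relation to a rewriting rule -/

section Relation

variable {K : Type*} {B : Type*} [Field K] [Ring B] [Algebra K B] {Λ : Set ℤ} {e : ℤ → B}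
  {k : ℕ}

/-- The twisted product of `g` with a single exponent `n`. -/
noncomputable def twist (e : ℤ → B) (g : (Fin k → ℤ) →₀ K) (n : Fin k → ℤ) : B :=
  ∑ v ∈ g.support, g v • ((∏ s, (v s - n s) : ℤ) : K) • word e (v + n)

/-- If `σ s = σ s'`, moving a unit from `n s` to `n s'` leaves the word unchanged, while the
coefficient is a product of `k` affine functions of `n`. -/
theorem laurentPairing_commutator_eq_zero {a : AddMonoidAlgebra K (Fin k → ℤ)}
    (ha : ∀ p : Fin k × Fin k, p.1 < p.2 → oneSubRatio K p ^ (k + 1) ∣ a) (n₀ v : Fin k → ℤ)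
    {σ : Fin k → Fin k} (hσ : ¬ Function.Injective σ) :
    laurentPairing (fun n => (commutatorCoeff σ v n : K) • word e (v + fibreSum σ n))
      (AddMonoidAlgebra.single n₀ 1 * a) = 0 := by
  obtain ⟨s, s', hss, hlt⟩ : ∃ s s', σ s = σ s' ∧ s < s' := by
    simp only [Function.Injective, not_forall] at hσ
    obtain ⟨s, s', h, hne⟩ := hσ
    rcases lt_or_gt_of_ne hne with h' | h'
    · exact ⟨s, s', h, h'⟩
    · exact ⟨s', s, h.symm, h'⟩
  have := laurentPairing_eq_zero_of_invariant (M := B) ha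
    (t := fun s n => ((v (σ s) + (∑ s', if s < s' ∧ σ s' = σ s then n s' else 0) - n s : ℤ) : K))
    (fun s g => ⟨(((∑ s', if s < s' ∧ σ s' = σ s then g s' else 0) - g s : ℤ) : K), fun n => ?_⟩)
    (h := fun n => word e (v + fibreSum σ n)) hlt
    (fun n => by rw [fibreSum_add, fibreSum_single_sub_single hss, add_zero]) n₀
  · simpa only [commutatorCoeff, Int.cast_prod] using this
  · rw [← Int.cast_add]
    congr 1
    have : (∑ s', if s < s' ∧ σ s' = σ s then (n + g) s' else 0) =
        (∑ s', if s < s' ∧ σ s' = σ s then n s' else 0) +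
          ∑ s', if s < s' ∧ σ s' = σ s then g s' else 0 := by
      rw [← Finset.sum_add_distrib]
      exact Finset.sum_congr rfl fun s' _ => by split_ifs <;> simp
    rw [this, Pi.add_apply]
    ring

namespace WittRelations

variable {θ : ℤ → ℤ → K}

/-- For a permutation, reorder the letters of `v + fibreSum σ n` so that the increment becomes `n`
itself; this replaces `v` by `v ∘ σ`, and symmetry of `g` removes the difference. -/
theorem sum_injective_sub_twist_mem (H : WittRelations Λ θ e) {g : (Fin k → ℤ) →₀ K}
    (hsymm : ∀ (σ : Equiv.Perm (Fin k)) v, g (v ∘ σ) = g v)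
    (hΛ : ∀ v ∈ g.support, ∀ s, v s ∈ Λ) {w : ℕ} (hw : ∀ v ∈ g.support, ∑ s, (v s).natAbs ≤ w)
    {n : Fin k → ℤ} (hn : ∀ s, n s ∈ Λ) {σ : Fin k → Fin k} (hσ : Function.Injective σ) :
    ∑ v ∈ g.support, g v • (commutatorCoeff σ v n : K) • word e (v + fibreSum σ n) - twist e g n ∈
      wordSpan K Λ e k (w + ∑ s, (n s).natAbs) := by
  obtain ⟨τ, rfl⟩ : ∃ τ : Equiv.Perm (Fin k), σ = τ :=
    ⟨Equiv.ofBijective σ (Finite.injective_iff_bijective.1 hσ), rfl⟩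
  have h1 : twist e g n =
      ∑ v ∈ g.support, g v • (commutatorCoeff τ v n : K) • word e (v ∘ τ + n) := by
    refine (Finset.sum_bij' (fun v _ => v ∘ τ) (fun v _ => v ∘ τ.symm) ?_ ?_ ?_ ?_ ?_).symm
    · intro v hv; rw [Finsupp.mem_support_iff, hsymm]; exact Finsupp.mem_support_iff.1 hv
    · intro v hv; rw [Finsupp.mem_support_iff, hsymm]; exact Finsupp.mem_support_iff.1 hv
    · intro v _; funext s; simp
    · intro v _; funext s; simp
    · intro v _
      rw [hsymm, commutatorCoeff_of_injective τ.injective]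
      rfl
  rw [h1, ← Finset.sum_sub_distrib]
  refine Submodule.sum_mem _ fun v hv => ?_
  rw [← smul_sub, ← smul_sub]
  refine Submodule.smul_mem _ _ (Submodule.smul_mem _ _ ?_)
  have h2 : v ∘ τ + n = (v + fibreSum τ n) ∘ τ := by
    funext s; simp [fibreSum_apply_of_injective τ.injective]
  have h3 := H.prod_sub_prod_mem_of_perm (l := List.ofFn (v + fibreSum τ n))
    (Equiv.Perm.ofFn_comp_perm τ (v + fibreSum τ n)).symm (fun i hi => by
      obtain ⟨s, rfl⟩ := List.mem_ofFn.1 hi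
      exact H.add_fibreSum_mem _ (hΛ v hv) hn s)
  rw [h2]
  refine wordSpan_mono (by simp) ?_ h3
  rw [absSum_ofFn]
  exact (sum_natAbs_add_fibreSum_le _ _ _).trans (by have := hw v hv; omega)

/-- Commuting preserves the bound on length, so the combined relation is still made of words shorter
than `k`. Its surviving leading part is the number of permutations times one twisted sum, and that
number is invertible in characteristic zero. -/
theorem laurentPairing_twist_mem [CharZero K] (H : WittRelations Λ θ e) {g : (Fin k → ℤ) →₀ K}
    (hsymm : ∀ (σ : Equiv.Perm (Fin k)) v, g (v ∘ σ) = g v)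
    (hΛ : ∀ v ∈ g.support, ∀ s, v s ∈ Λ) {w : ℕ} (hw : ∀ v ∈ g.support, ∑ s, (v s).natAbs ≤ w)
    (hg : ∑ v ∈ g.support, g v • word e v ∈ wordSpan K Λ e k w)
    {a : AddMonoidAlgebra K (Fin k → ℤ)}
    (ha : ∀ p : Fin k × Fin k, p.1 < p.2 → oneSubRatio K p ^ (k + 1) ∣ a) {n₀ : Fin k → ℤ} {w' : ℕ}
    (hn : ∀ ρ ∈ a.coeff.support, (∀ s, (n₀ + ρ) s ∈ Λ) ∧ ∑ s, ((n₀ + ρ) s).natAbs ≤ w') :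
    laurentPairing (fun ρ => twist e g (n₀ + ρ)) a ∈ wordSpan K Λ e k (w + w') := by
  classical
  set S : Finset (Fin k → Fin k) := Finset.univ.filter Function.Injective
  have h1 : laurentPairing (fun n => ∑ v ∈ g.support, g v •
      ∑ σ : Fin k → Fin k, (commutatorCoeff σ v n : K) • word e (v + fibreSum σ n))
        (AddMonoidAlgebra.single n₀ 1 * a) =
      laurentPairing (fun n => ∑ v ∈ g.support, g v •
      ∑ σ ∈ S, (commutatorCoeff σ v n : K) • word e (v + fibreSum σ n))
        (AddMonoidAlgebra.single n₀ 1 * a) := by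
    simp only [laurentPairing_sum_left, laurentPairing_smul_left]
    refine Finset.sum_congr rfl fun v _ => ?_
    congr 1
    refine (Finset.sum_subset (Finset.subset_univ S) fun σ _ hσ => ?_).symm
    refine laurentPairing_commutator_eq_zero ha n₀ v fun h => hσ ?_
    exact Finset.mem_filter.2 ⟨Finset.mem_univ σ, h⟩
  rw [laurentPairing_single_mul, laurentPairing_single_mul] at h1
  have h2 : laurentPairing (fun ρ => ∑ v ∈ g.support, g v •
      ∑ σ : Fin k → Fin k, (commutatorCoeff σ v (n₀ + ρ) : K) •
        word e (v + fibreSum σ (n₀ + ρ))) a ∈ wordSpan K Λ e k (w + w') := by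
    refine laurentPairing_mem fun ρ hρ => ?_
    obtain ⟨h3, h4⟩ := hn ρ hρ
    have h5 := H.iterCommutator_mem h3 hg
    rw [iterCommutator_sum] at h5
    have h6 : ∑ v ∈ g.support, g v • (iterCommutator e (n₀ + ρ) (word e v) -
        ∑ σ : Fin k → Fin k, (commutatorCoeff σ v (n₀ + ρ) : K) •
          word e (v + fibreSum σ (n₀ + ρ))) ∈ wordSpan K Λ e k (w + w') :=
      Submodule.sum_mem _ fun v hv => Submodule.smul_mem _ _
        (wordSpan_mono le_rfl (add_le_add (hw v hv) h4) (H.iterCommutator_word_sub_mem h3 (hΛ v hv)))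
    have h7 := sub_mem (wordSpan_mono le_rfl (add_le_add le_rfl h4) h5) h6
    simpa only [smul_sub, Finset.sum_sub_distrib, sub_sub_cancel] using h7
  rw [h1] at h2
  have h3 : laurentPairing (fun ρ => ∑ v ∈ g.support, g v •
      ∑ σ ∈ S, (commutatorCoeff σ v (n₀ + ρ) : K) • word e (v + fibreSum σ (n₀ + ρ)) -
        (S.card : K) • twist e g (n₀ + ρ)) a ∈ wordSpan K Λ e k (w + w') := by
    refine laurentPairing_mem fun ρ hρ => ?_
    obtain ⟨h3, h4⟩ := hn ρ hρ
    have h5 : ∑ σ ∈ S, (∑ v ∈ g.support, g v • (commutatorCoeff σ v (n₀ + ρ) : K) •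
        word e (v + fibreSum σ (n₀ + ρ)) - twist e g (n₀ + ρ)) ∈ wordSpan K Λ e k (w + w') :=
      Submodule.sum_mem _ fun σ hσ => wordSpan_mono le_rfl (add_le_add le_rfl h4)
        (H.sum_injective_sub_twist_mem hsymm hΛ hw h3 (Finset.mem_filter.1 hσ).2)
    rw [Finset.sum_sub_distrib, Finset.sum_comm, Finset.sum_const, ← Nat.cast_smul_eq_nsmul K] at h5
    simpa only [Finset.smul_sum] using h5
  rw [laurentPairing_sub_left, laurentPairing_smul_left] at h3
  have h4 := sub_mem h2 h3
  rw [sub_sub_cancel] at h4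
  have hS : (S.card : K) ≠ 0 := by
    rw [Nat.cast_ne_zero, Finset.card_ne_zero]
    exact ⟨id, Finset.mem_filter.2 ⟨Finset.mem_univ _, Function.injective_id⟩⟩
  exact (Submodule.smul_mem_iff _ hS).1 h4

end WittRelations

/-- Words obtained from `i` by a bounded change which is negative in the order adapted to the
signs of `i`. -/
def IsLowerWord (Λ : Set ℤ) (C : ℕ) (i j : Fin k → ℤ) : Prop :=
  (∀ s, j s ∈ Λ) ∧ weightedLex (fun s => (i s).sign) (j - i) < 0 ∧
    ∀ s, (j s - i s).natAbs ≤ C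

theorem natAbs_le_sum (v : Fin k → ℤ) (s : Fin k) : (v s).natAbs ≤ ∑ s, (v s).natAbs :=
  Finset.single_le_sum (f := fun s => (v s).natAbs) (fun _ _ => Nat.zero_le _) (Finset.mem_univ s)

theorem sum_natAbs_add_le (u v : Fin k → ℤ) :
    ∑ s, ((u + v) s).natAbs ≤ ∑ s, (u s).natAbs + ∑ s, (v s).natAbs := by
  rw [← Finset.sum_add_distrib]
  exact Finset.sum_le_sum fun s _ => Int.natAbs_add_le _ _

/-- In the combined relation the words are `v + n₀ + ρ`. The largest `v` together with `ρ = 0` gives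
the unique top term, and `n₀` is chosen to make it `i`. -/
theorem WittRelations.exists_word_mem [CharZero K] {θ : ℤ → ℤ → K} (H : WittRelations Λ θ e)
    (hstable : ∀ (C : ℕ), ∀ i ∈ Λ, C < i.natAbs → ∀ t : ℤ, t.natAbs ≤ C → i + t ∈ Λ)
    {g : (Fin k → ℤ) →₀ K} (hg0 : g ≠ 0) (hsymm : ∀ (σ : Equiv.Perm (Fin k)) v, g (v ∘ σ) = g v)
    (hΛ : ∀ v ∈ g.support, ∀ s, v s ∈ Λ) {w : ℕ} (hw : ∀ v ∈ g.support, ∑ s, (v s).natAbs ≤ w)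
    (hg : ∑ v ∈ g.support, g v • word e v ∈ wordSpan K Λ e k w) :
    ∃ C : ℕ, ∀ i : Fin k → ℤ, Antitone i → (∀ s, i s ∈ Λ) → (∀ s, C < (i s).natAbs) →
      word e i ∈ Submodule.span K (word e '' {j | IsLowerWord Λ C i j}) ⊔
        wordSpan K Λ e k (∑ s, (i s).natAbs + C) := by
  classical
  obtain ⟨a, ha1, ha⟩ := exists_oneSubRatio_pow_dvd K k
  obtain ⟨c, hc⟩ : ∃ c : ℕ, ∀ ρ ∈ a.coeff.support, ∑ s, (ρ s).natAbs ≤ c :=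
    ⟨_, fun ρ hρ => Finset.le_sup (f := fun ρ : Fin k → ℤ => ∑ s, (ρ s).natAbs) hρ⟩
  obtain ⟨c', hc'⟩ : ∃ c : ℕ, ∀ ρ ∈ (a - 1).coeff.support, ∑ s, (ρ s).natAbs ≤ c :=
    ⟨_, fun ρ hρ => Finset.le_sup (f := fun ρ : Fin k → ℤ => ∑ s, (ρ s).natAbs) hρ⟩
  -- Here `2 * w` bounds `v - v₀`, while `c` and `c'` bound the exponents of `a` and `a - 1`. The
  -- constant is fixed before `i`, so it does not depend on the signs of `i`.
  refine ⟨2 * w + c + c', fun i hi hiΛ hiC => ?_⟩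
  set C := 2 * w + c + c'
  set ε : Fin k → ℤ := fun s => (i s).sign with hεdef
  have hε : Antitone ε := fun s t hst => by
    have := hi hst
    rcases lt_trichotomy (i s) 0 with h | h | h <;> rcases lt_trichotomy (i t) 0 with h' | h' | h' <;>
      simp [hεdef, Int.sign_eq_one_of_pos, Int.sign_eq_neg_one_of_neg, h, h'] <;> omega
  obtain ⟨v₀, hv₀, hmax⟩ := Finset.exists_max_image g.support (weightedLex ε)
    (Finsupp.support_nonempty_iff.2 hg0)
  set T := Submodule.span K (word e '' {j | IsLowerWord Λ C i j})
  set n₀ := i - v₀ with hn₀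
  have hvw (v) (hv : v ∈ g.support) (s) : (v s).natAbs ≤ w := (natAbs_le_sum v s).trans (hw v hv)
  have hlow (v) (hv : v ∈ g.support) (ρ : Fin k → ℤ) (hρ : ∀ s, (ρ s).natAbs ≤ c')
      (hlt : weightedLex ε (v - v₀) + weightedLex ε ρ < 0) : word e (v + (n₀ + ρ)) ∈ T := by
    refine Submodule.subset_span ⟨_, ⟨fun s => ?_, ?_, fun s => ?_⟩, rfl⟩
    · have : (v + (n₀ + ρ)) s = i s + (v s - v₀ s + ρ s) := by simp [hn₀]; ring
      rw [this]
      refine hstable C _ (hiΛ s) (hiC s) _ ?_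
      have := hvw v hv s; have := hvw v₀ hv₀ s; have := hρ s
      omega
    · rw [← weightedLex_add] at hlt
      convert hlt using 2
      rw [hn₀]; abel
    · have : (v + (n₀ + ρ)) s - i s = v s - v₀ s + ρ s := by simp [hn₀]; ring
      rw [this]
      have := hvw v hv s; have := hvw v₀ hv₀ s; have := hρ s
      omega
  have hle (v) (hv : v ∈ g.support) : weightedLex ε (v - v₀) ≤ 0 := by
    rw [weightedLex_sub, sub_nonpos]; exact hmax v hv
  have hP := H.laurentPairing_twist_mem hsymm hΛ hw hg ha (n₀ := n₀)
    (w' := ∑ s, (i s).natAbs + w + c) (fun ρ hρ => ⟨fun s => by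
      have : (n₀ + ρ) s = i s + (ρ s - v₀ s) := by simp [hn₀]; ring
      rw [this]
      refine hstable C _ (hiΛ s) (hiC s) _ ?_
      have := hvw v₀ hv₀ s; have := (natAbs_le_sum ρ s).trans (hc ρ hρ)
      omega, by
      have h1 := sum_natAbs_add_le n₀ ρ
      have h2 := sum_natAbs_add_le i (-v₀)
      rw [← sub_eq_add_neg, ← hn₀] at h2
      simp only [Pi.neg_apply, Int.natAbs_neg] at h2
      have := hw v₀ hv₀; have := hc ρ hρ
      omega⟩)
  have hdecomp : laurentPairing (fun ρ => twist e g (n₀ + ρ)) a =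
      laurentPairing (fun ρ => twist e g (n₀ + ρ)) (a - 1) + twist e g (n₀ + 0) := by
    conv_lhs => rw [← sub_add_cancel a 1, map_add, AddMonoidAlgebra.one_def, laurentPairing_single,
      one_smul]
    rfl
  have hrest : laurentPairing (fun ρ => twist e g (n₀ + ρ)) (a - 1) ∈ T := by
    refine laurentPairing_mem fun ρ hρ => Submodule.sum_mem _ fun v hv =>
      Submodule.smul_mem _ _ (Submodule.smul_mem _ _ (hlow v hv ρ
        (fun s => (natAbs_le_sum ρ s).trans (hc' ρ hρ)) ?_))
    exact add_neg_of_nonpos_of_neg (hle v hv) (ha1 ρ (Finsupp.mem_support_iff.1 hρ) ε hε)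
  -- The factors are `v₀ s - n₀ s = 2 * v₀ s - i s`, nonzero because `|i s| > 2 * w`.
  have hcoeff : g v₀ * ((∏ s, (v₀ s - (n₀ + 0) s) : ℤ) : K) ≠ 0 := by
    refine mul_ne_zero (Finsupp.mem_support_iff.1 hv₀) (Int.cast_ne_zero.2
      (Finset.prod_ne_zero_iff.2 fun s _ => ?_))
    have := hvw v₀ hv₀ s; have := hiC s
    simp only [hn₀, Pi.add_apply, Pi.sub_apply, Pi.zero_apply]
    omega
  have htwist : twist e g (n₀ + 0) -
      (g v₀ * ((∏ s, (v₀ s - (n₀ + 0) s) : ℤ) : K)) • word e i ∈ T := by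
    have : v₀ + (n₀ + 0) = i := by rw [hn₀]; abel
    rw [twist, ← Finset.add_sum_erase _ _ hv₀, this, smul_smul, add_sub_cancel_left]
    refine Submodule.sum_mem _ fun v hv => Submodule.smul_mem _ _ (Submodule.smul_mem _ _
      (hlow v (Finset.mem_of_mem_erase hv) 0 (by simp) ?_))
    refine add_neg_of_neg_of_nonpos (lt_of_le_of_ne (hle v (Finset.mem_of_mem_erase hv)) ?_) ?_
    · intro h0
      rw [weightedLex_sub, sub_eq_zero] at h0
      exact (Finset.ne_of_mem_erase hv) (weightedLex_injective ε h0)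
    · have : weightedLex ε (0 : Fin k → ℤ) = 0 := by
        have := weightedLex_sub ε 0 0
        rwa [sub_self, sub_self] at this
      exact this.le
  rw [hdecomp] at hP
  refine (Submodule.smul_mem_iff _ hcoeff).1 ?_
  have hW := wordSpan_mono (K := K) (Λ := Λ) (e := e) (le_refl k)
    (show w + (∑ s, (i s).natAbs + w + c) ≤ ∑ s, (i s).natAbs + C by omega) hP
  have hT := add_mem hrest htwist
  have := sub_mem (Submodule.mem_sup_right (S := T) hW)
    (Submodule.mem_sup_left (T := wordSpan K Λ e k (∑ s, (i s).natAbs + C)) hT)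
  convert this using 1
  abel

end Relation

/-! ### Reduction to words with clustered letters -/

/-- A bounded change of well separated letters which is negative for `weightedLex` decreases
`∑ |i|`, or preserves it and decreases `∑ 2 ^ (i + m)`. -/
theorem IsLowerWord.lt {Λ : Set ℤ} {k C m : ℕ} {i j : Fin k → ℤ} (h : IsLowerWord Λ C i j)
    (hC : ∀ s, C < (i s).natAbs) (hgap : ∀ s t, s < t → i t + (C + k : ℕ) < i s)
    (hm : ∑ s, (i s).natAbs ≤ m) :
    ∑ s, (j s).natAbs < ∑ s, (i s).natAbs ∨ ∑ s, (j s).natAbs = ∑ s, (i s).natAbs ∧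
      ∑ s, 2 ^ (j s + m).toNat < ∑ s, 2 ^ (i s + m).toNat := by
  obtain ⟨-, hlt, hbd⟩ := h
  -- A change of at most `C < |i s|` cannot flip a sign, so `∑ |i|` varies linearly, with the signs
  -- as weights.
  have hsum : (∑ s, (j s).natAbs : ℕ) = ((∑ s, (i s).natAbs : ℕ) : ℤ) +
      ∑ s, (i s).sign * (j - i) s := by
    rw [Nat.cast_sum, Nat.cast_sum, ← Finset.sum_add_distrib]
    refine Finset.sum_congr rfl fun s _ => ?_
    have h1 := hC s; have h2 := hbd s
    rw [Pi.sub_apply]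
    rcases lt_trichotomy (i s) 0 with h | h | h
    · rw [Int.sign_eq_neg_one_of_neg h]; omega
    · omega
    · rw [Int.sign_eq_one_of_pos h]; omega
  rw [weightedLex_neg_iff] at hlt
  rcases hlt with hlt | ⟨h0, r, hr0, hr⟩
  · left; omega
  · right
    have heq : ∑ s, (j s).natAbs = ∑ s, (i s).natAbs := by omega
    refine ⟨heq, ?_⟩
    have hj (s) : -(m : ℤ) ≤ j s := by have := natAbs_le_sum j s; omega
    set X : ℕ := 2 ^ (i r + m).toNat with hX
    have hXpos : 0 < X := by positivity
    -- At `r` at least half of `X` is lost. By the gap `C + k`, each later entry contributes at most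
    -- `X / 2 ^ (k + 1)` after the change. Summing and using `k < 2 ^ k` gives a strict decrease.
    have hkey (s) : 2 ^ (k + 1) * 2 ^ (j s + m).toNat + (if s = r then 2 ^ k * X else 0) ≤
        2 ^ (k + 1) * 2 ^ (i s + m).toNat + X := by
      rcases lt_trichotomy s r with h | h | h
      · have := hr0 s h
        rw [Pi.sub_apply, sub_eq_zero] at this
        rw [this, if_neg h.ne]
        omega
      · subst h
        rw [if_pos rfl, ← hX]
        have h1 : 2 * 2 ^ (j s + m).toNat ≤ X := by
          rw [← pow_succ', hX]
          refine Nat.pow_le_pow_right (by norm_num) ?_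
          have := hj s; rw [Pi.sub_apply] at hr; omega
        have h2 := Nat.mul_le_mul_left (2 ^ k) h1
        rw [pow_succ]
        nlinarith
      · rw [if_neg h.ne']
        have h1 : 2 ^ (k + 1) * 2 ^ (j s + m).toNat ≤ X := by
          rw [← pow_add, hX]
          refine Nat.pow_le_pow_right (by norm_num) ?_
          have := hj s; have := hbd s; have := hgap r s h
          omega
        omega
    have htot := Finset.sum_le_sum fun s (_ : s ∈ Finset.univ) => hkey s
    rw [Finset.sum_add_distrib, Finset.sum_add_distrib, ← Finset.mul_sum, ← Finset.mul_sum] at htot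
    simp only [Finset.sum_ite_eq', Finset.mem_univ, if_true, Finset.sum_const, Finset.card_univ,
      Fintype.card_fin, smul_eq_mul] at htot
    have hk := Nat.mul_lt_mul_of_pos_right (Nat.lt_two_pow_self (n := k)) hXpos
    exact lt_of_mul_lt_mul_left (by omega) (Nat.zero_le (2 ^ (k + 1)))

/-- Greedy choice: take the maximum as next letter or centre, discard everything within distance `N`
of it, and recurse. -/
theorem exists_separated_or_covered (N k : ℕ) (X : Finset ℤ) :
    (∃ i : Fin k → ℤ, (∀ s, i s ∈ X) ∧ ∀ s t, s < t → i t + N < i s) ∨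
      ∃ c : Fin k → ℤ, (∀ s, c s ∈ X ∨ c s = 0) ∧ ∀ x ∈ X, ∃ s, (x - c s).natAbs ≤ N := by
  induction k generalizing X with
  | zero => exact Or.inl ⟨Fin.elim0, fun s => s.elim0, fun s => s.elim0⟩
  | succ k ih =>
    rcases X.eq_empty_or_nonempty with rfl | hX
    · exact Or.inr ⟨fun _ => 0, fun _ => Or.inr rfl, by simp⟩
    have hmax := X.max'_mem hX
    set x₀ := X.max' hX
    rcases ih (X.filter fun x => x + N < x₀) with ⟨i, hi, hgap⟩ | ⟨c, hc, hcov⟩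
    · refine Or.inl ⟨Fin.cons x₀ i, fun s => ?_, fun s t hst => ?_⟩
      · refine Fin.cases hmax (fun s => ?_) s
        exact (Finset.mem_filter.1 (hi s)).1
      · induction t using Fin.cases with
        | zero => exact absurd hst (Fin.not_lt_zero s)
        | succ t =>
          induction s using Fin.cases with
          | zero => exact (Finset.mem_filter.1 (hi t)).2
          | succ s => exact hgap s t (Fin.succ_lt_succ_iff.1 hst)
    · refine Or.inr ⟨Fin.cons x₀ c, fun s => ?_, fun x hx => ?_⟩
      · refine Fin.cases (Or.inl hmax) (fun s => ?_) s
        exact (hc s).imp_left fun h => (Finset.mem_filter.1 h).1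
      · by_cases h : x + N < x₀
        · obtain ⟨s, hs⟩ := hcov x (Finset.mem_filter.2 ⟨hx, h⟩)
          exact ⟨s.succ, hs⟩
        · refine ⟨0, ?_⟩
          have := X.le_max' x hx
          simp only [Fin.cons_zero]
          omega

theorem natAbs_le_absSum {l : List ℤ} {i : ℤ} (h : i ∈ l) : i.natAbs ≤ absSum l :=
  List.single_le_sum (by simp) _ (List.mem_map_of_mem h)

/-- The letters of `l` lie within distance `N` of at most `k` centres. -/
def IsClustered (N k m : ℕ) (l : Multiset ℤ) : Prop :=
  ∃ c : Fin k → ℤ, (∀ s, (c s).natAbs ≤ m) ∧ ∀ x ∈ l, ∃ s, (x - c s).natAbs ≤ N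

/-! ### Clustered words span, and there are polynomially many -/

section Clustered

variable (K : Type*) {B : Type*} [Field K] [Ring B] [Algebra K B] (Λ : Set ℤ) (e : ℤ → B)

/-- The span of the words in `Λ` with `∑ (|i| + D) ≤ m`. -/
def weightSpan (D m : ℕ) : Submodule K B :=
  Submodule.span K {x | ∃ l : List ℤ, (∀ i ∈ l, i ∈ Λ) ∧ absSum l + D * l.length ≤ m ∧
    (l.map e).prod = x}

/-- The span of one word for every multiset of at most `m` clustered letters. -/
noncomputable def clusterSpan (N k m : ℕ) : Submodule K B :=
  Submodule.span K {x | ∃ M : Multiset ℤ, IsClustered N k m M ∧ M.card ≤ m ∧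
    (M.toList.map e).prod = x}

variable {K Λ e} {k C : ℕ}

theorem wordSpan_le_of_forall {d w : ℕ} {S : Submodule K B}
    (h : ∀ l : List ℤ, (∀ i ∈ l, i ∈ Λ) → l.length < d → absSum l ≤ w → (l.map e).prod ∈ S) :
    wordSpan K Λ e d w ≤ S :=
  Submodule.span_le.2 (by rintro _ ⟨l, h1, h2, h3, rfl⟩; exact h l h1 h2 h3)

/-- Nested induction on the length, then `∑ |i|`, then the potential `∑ 2 ^ (i + m)`: rewriting `k`
separated large letters decreases this triple lexicographically. -/
theorem WittRelations.prod_mem_clusterSpan {θ : ℤ → ℤ → K} (H : WittRelations Λ θ e)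
    (hred : ∀ i : Fin k → ℤ, Antitone i → (∀ s, i s ∈ Λ) → (∀ s, C < (i s).natAbs) →
      word e i ∈ Submodule.span K (word e '' {j | IsLowerWord Λ C i j}) ⊔
        wordSpan K Λ e k (∑ s, (i s).natAbs + C)) (m : ℕ) (d a p : ℕ) (l : List ℤ)
    (hl : ∀ i ∈ l, i ∈ Λ) (hm : absSum l + (C + 1) * l.length ≤ m) (hd : l.length = d)
    (ha : absSum l = a) (hp : (l.map fun i : ℤ => 2 ^ (i + m).toNat).sum = p) :
    (l.map e).prod ∈ clusterSpan K e (C + k) (k + 1) m := by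
  induction d using Nat.strong_induction_on generalizing a p l with
  | _ d ihd =>
  induction a using Nat.strong_induction_on generalizing p l with
  | _ a iha =>
  induction p using Nat.strong_induction_on generalizing l with
  | _ p ihp =>
  set S := clusterSpan K e (C + k) (k + 1) m
  -- This is why each letter carries the extra weight `C + 1`: a reduction may raise `∑ |i|` by `C`,
  -- but then it loses at least one letter.
  have hlower (w : ℕ) (hw : w ≤ a + C) : wordSpan K Λ e d w ≤ S := by
    refine wordSpan_le_of_forall fun l' h1 h2 h3 => ihd _ h2 _ _ l' h1 ?_ rfl rfl rfl
    have : (C + 1) * (l'.length + 1) ≤ (C + 1) * l.length := Nat.mul_le_mul_left _ (by omega)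
    rw [mul_add] at this
    omega
  have hperm {l' : List ℤ} (h : l.Perm l') (h' : (l'.map e).prod ∈ S) : (l.map e).prod ∈ S := by
    have := H.prod_sub_prod_mem_of_perm h hl
    rw [hd, ha] at this
    simpa using add_mem (hlower a (by omega) this) h'
  have hmem (i) (hi : i ∈ l) : i.natAbs ≤ m := (natAbs_le_absSum hi).trans (by omega)
  -- Only letters with `|i| > C + k` are tested; the others belong to the additional centre `0`,
  -- whence `k + 1` centres.
  rcases exists_separated_or_covered (C + k) k
    (l.toFinset.filter fun i => C + k < i.natAbs) with ⟨i, hi, hgap⟩ | ⟨c, hc, hcov⟩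
  · simp only [Finset.mem_filter, List.mem_toFinset] at hi
    have hinj : Function.Injective i := fun s t hst => by
      rcases lt_trichotomy s t with h | h | h
      · have := hgap s t h; omega
      · exact h
      · have := hgap t s h; omega
    obtain ⟨l', hl'⟩ : ∃ l', l.Perm (List.ofFn i ++ l') := by
      obtain ⟨l₁, h₁, h₂⟩ := (List.nodup_ofFn.2 hinj).subperm (l₂ := l) fun x hx => by
        obtain ⟨s, rfl⟩ := List.mem_ofFn.1 hx; exact (hi s).1
      obtain ⟨l', h⟩ := h₂.exists_perm_append
      exact ⟨l', h.trans (h₁.append_right _)⟩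
    refine hperm hl' ?_
    have hl'Λ : ∀ i ∈ l', i ∈ Λ := fun i hi =>
      hl i (hl'.mem_iff.2 (List.mem_append.2 (Or.inr hi)))
    have hlen : k + l'.length = d := by
      rw [← hd, hl'.length_eq, List.length_append, List.length_ofFn]
    have habs : ∑ s, (i s).natAbs + absSum l' = a := by
      rw [← ha, hl'.absSum_eq, absSum_append, absSum_ofFn]
    have hpot : ∑ s, 2 ^ (i s + m).toNat + (l'.map fun i : ℤ => 2 ^ (i + m).toNat).sum = p := by
      rw [← hp, (hl'.map _).sum_eq, List.map_append, List.sum_append, List.map_ofFn, List.sum_ofFn]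
      rfl
    rw [List.map_append, List.prod_append]
    change word e i * _ ∈ S
    have hanti : Antitone i := fun s t hst => by
      rcases hst.lt_or_eq with h | rfl
      · have := hgap s t h; omega
      · rfl
    have hCi (s) : C < (i s).natAbs := by have := (hi s).2; omega
    refine (sup_le (c := S.comap (LinearMap.mulRight K (l'.map e).prod)) ?_ ?_ :
      _ ⊔ _ ≤ _) (hred i hanti (fun s => hl _ (hi s).1) hCi)
    · rw [Submodule.span_le]
      rintro _ ⟨j, hj, rfl⟩
      change word e j * (l'.map e).prod ∈ S
      have hjl : ∀ x ∈ List.ofFn j ++ l', x ∈ Λ := fun x hx => by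
        rcases List.mem_append.1 hx with hx | hx
        · obtain ⟨s, rfl⟩ := List.mem_ofFn.1 hx; exact hj.1 s
        · exact hl'Λ x hx
      have hja : absSum (List.ofFn j ++ l') = ∑ s, (j s).natAbs + absSum l' := by
        rw [absSum_append, absSum_ofFn]
      have hjd : (List.ofFn j ++ l').length = d := by
        rw [List.length_append, List.length_ofFn, hlen]
      rw [word, ← List.prod_append, ← List.map_append]
      have hlt := hj.lt hCi hgap (m := m) (by omega)
      have hjm : absSum (List.ofFn j ++ l') + (C + 1) * (List.ofFn j ++ l').length ≤ m := by
        rw [hja, hjd, ← hd]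
        rcases hlt with hlt | ⟨hlt, -⟩ <;> omega
      rcases hlt with hlt | ⟨heq, hlt⟩
      · exact iha _ (by omega) _ _ hjl hjm hjd hja rfl
      · refine ihp _ ?_ _ hjl hjm hjd (by omega) rfl
        rw [List.map_append, List.sum_append, List.map_ofFn, List.sum_ofFn, ← hpot]
        exact Nat.add_lt_add_right hlt _
    · intro x hx
      have := mul_prod_mem_wordSpan hl'Λ hx
      rw [hlen] at this
      exact hlower _ (by omega) this
  · refine hperm (Multiset.coe_eq_coe.1 (Multiset.coe_toList (l : Multiset ℤ))).symm ?_
    refine Submodule.subset_span ⟨_, ⟨Fin.cons 0 c, fun s => ?_, fun x hx => ?_⟩, ?_, rfl⟩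
    · refine Fin.cases (by simp) (fun s => ?_) s
      rcases hc s with h | h
      · exact hmem _ (List.mem_toFinset.1 (Finset.mem_filter.1 h).1)
      · simp [h]
    · by_cases h : C + k < x.natAbs
      · obtain ⟨s, hs⟩ := hcov x (Finset.mem_filter.2 ⟨List.mem_toFinset.2 hx, h⟩)
        exact ⟨s.succ, hs⟩
      · exact ⟨0, by simpa using h⟩
    · have : l.length ≤ (C + 1) * l.length := Nat.le_mul_of_pos_left _ (by omega)
      rw [Multiset.coe_card]
      omega

/-- The multiset with prescribed centres and multiplicities. -/
def clusterMultiset {N k m : ℕ}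
    (x : (Fin k → Fin (2 * m + 1)) × (Fin k × Fin (2 * N + 1) → Fin (m + 1))) : Multiset ℤ :=
  ∑ q, (x.2 q : ℕ) • {((x.1 q.1 : ℕ) : ℤ) - m + ((q.2 : ℕ) - N)}

/-- Every letter is assigned one centre and an offset from it, so overlapping clusters cause no
double counting. -/
theorem IsClustered.exists_clusterMultiset {N k m : ℕ} {M : Multiset ℤ}
    (h : IsClustered N k m M) (hM : M.card ≤ m) :
    ∃ x : (Fin k → Fin (2 * m + 1)) × (Fin k × Fin (2 * N + 1) → Fin (m + 1)),
      clusterMultiset x = M := by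
  classical
  obtain ⟨c, hc, hcov⟩ := h
  rcases M.empty_or_exists_mem with rfl | ⟨y, hy⟩
  · exact ⟨⟨fun _ => 0, fun _ => 0⟩, by simp [clusterMultiset]⟩
  have : Nonempty (Fin k) := ⟨(hcov y hy).choose⟩
  choose! f hf using hcov
  let b : ℤ → Fin k × Fin (2 * N + 1) := fun x => (f x, Fin.ofNat _ (x - c (f x) + N).toNat)
  refine ⟨⟨fun s => ⟨(c s + m).toNat, by have := hc s; omega⟩,
    fun q => ⟨(M.map b).count q, Nat.lt_succ_of_le ((Multiset.count_le_card _ _).trans (by simpa))⟩⟩, ?_⟩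
  have h1 : (M.map b).map (fun q => c q.1 + ((q.2 : ℕ) - N)) = M := by
    rw [Multiset.map_map]
    conv_rhs => rw [← Multiset.map_id M]
    refine Multiset.map_congr rfl fun x hx => ?_
    have := hf x hx
    simp only [b, Function.comp_apply, Fin.val_ofNat, id]
    rw [Nat.mod_eq_of_lt (by omega)]
    omega
  have h2 : ∑ q, (M.map b).count q • ({q} : Multiset (Fin k × Fin (2 * N + 1))) = M.map b := by
    ext q
    simp [Multiset.count_sum', Multiset.count_nsmul, Multiset.count_singleton]
  refine Eq.trans ?_ ((congrArg (Multiset.map fun q => c q.1 + ((q.2 : ℕ) - N)) h2).trans h1)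
  change _ = Multiset.mapAddMonoidHom (fun q : Fin k × Fin (2 * N + 1) => c q.1 + ((q.2 : ℕ) - N : ℤ))
    (∑ q, (M.map b).count q • {q})
  rw [map_sum]
  refine Finset.sum_congr rfl fun q _ => ?_
  rw [map_nsmul]
  simp only [Multiset.coe_mapAddMonoidHom, Multiset.map_singleton]
  congr 2
  have := hc q.1
  omega

theorem clusterSpan_le_range {N k m : ℕ} : clusterSpan K e N k m ≤ Submodule.span K (Set.range
    fun x : (Fin k → Fin (2 * m + 1)) × (Fin k × Fin (2 * N + 1) → Fin (m + 1)) =>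
      ((clusterMultiset x).toList.map e).prod) :=
  Submodule.span_mono (by
    rintro _ ⟨M, h1, h2, rfl⟩
    obtain ⟨x, rfl⟩ := h1.exists_clusterMultiset h2
    exact ⟨x, rfl⟩)

/-- The number of centres and the radius do not depend on `m`; only the positions of the centres and
the multiplicities do. The exponent `Q` counts these parameters. -/
theorem exists_weightSpan_le {θ : ℤ → ℤ → K} (H : WittRelations Λ θ e)
    (hred : ∀ i : Fin k → ℤ, Antitone i → (∀ s, i s ∈ Λ) → (∀ s, C < (i s).natAbs) →
      word e i ∈ Submodule.span K (word e '' {j | IsLowerWord Λ C i j}) ⊔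
        wordSpan K Λ e k (∑ s, (i s).natAbs + C)) :
    ∃ Q : ℕ, ∀ m, ∃ S : Submodule K B, weightSpan K Λ e (C + 1) m ≤ S ∧ S.FG ∧
      Module.finrank K S ≤ (2 * m + 1) ^ Q := by
  refine ⟨(k + 1) + (k + 1) * (2 * (C + k) + 1), fun m => ⟨Submodule.span K (Set.range
    fun x : (Fin (k + 1) → Fin (2 * m + 1)) × (Fin (k + 1) × Fin (2 * (C + k) + 1) → Fin (m + 1)) =>
      ((clusterMultiset x).toList.map e).prod), ?_, Submodule.fg_span (Set.finite_range _), ?_⟩⟩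
  · refine le_trans ?_ clusterSpan_le_range
    refine Submodule.span_le.2 ?_
    rintro _ ⟨l, h1, h2, rfl⟩
    exact H.prod_mem_clusterSpan hred m _ _ _ l h1 h2 rfl rfl rfl
  · refine (finrank_range_le_card (R := K) _).trans ?_
    simp only [Fintype.card_prod, Fintype.card_fun, Fintype.card_fin]
    rw [pow_add _ (k + 1)]
    exact Nat.mul_le_mul_left _ (Nat.pow_le_pow_left (show m + 1 ≤ 2 * m + 1 by omega) _)

end Clustered

/-! ### Finite Gelfand–Kirillov dimension -/

theorem gkDim_lt_top_of_filtration {K A : Type*} [Field K] [Ring A] [Algebra K A] (Q : ℕ)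
    (G : ℕ → Submodule K A) (hmono : Monotone G) (hone : 1 ∈ G 0)
    (hmul : ∀ m m' x y, x ∈ G m → y ∈ G m' → x * y ∈ G (m + m')) (hexh : ∀ x, ∃ m, x ∈ G m)
    (hfin : ∀ m, ∃ S, G m ≤ S ∧ S.FG ∧ Module.finrank K S ≤ (2 * m + 1) ^ Q) :
    gkDim K A < ⊤ := by
  refine lt_of_le_of_lt (b := ENNReal.ofReal (Q + 1)) ?_ ENNReal.ofReal_lt_top
  refine iSup₂_le fun V hV => ?_
  obtain ⟨m, hm⟩ : ∃ m, 1 ⊔ V ≤ G m := by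
    obtain ⟨s, rfl⟩ := hV
    choose f hf using hexh
    refine ⟨s.sup f, sup_le ?_ (Submodule.span_le.2 fun x hx => hmono (Finset.le_sup hx) (hf x))⟩
    rw [Submodule.one_eq_span, Submodule.span_singleton_le_iff_mem]
    exact hmono (Nat.zero_le _) hone
  have hpow (n : ℕ) : (1 ⊔ V) ^ n ≤ G (n * m) := by
    induction n with
    | zero => rw [pow_zero, zero_mul, Submodule.one_eq_span, Submodule.span_singleton_le_iff_mem]
              exact hone
    | succ n ih =>
      rw [pow_succ, add_mul, one_mul]
      exact Submodule.mul_le.2 fun x hx y hy => hmul _ _ x y (ih hx) (hm hy)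
  refine Filter.limsup_le_of_le (h := ?_)
  -- From this point on, the constant `(2 * m + 1) ^ Q` is absorbed into one additional factor `n`.
  filter_upwards [Filter.eventually_ge_atTop (max 2 ((2 * m + 1) ^ Q))] with n hn
  have hn2 : 2 ≤ n := le_trans (le_max_left _ _) hn
  have hnQ : (2 * m + 1) ^ Q ≤ n := le_trans (le_max_right _ _) hn
  refine ENNReal.ofReal_le_ofReal ?_
  have hlogn : 0 < Real.log n := Real.log_pos (by exact_mod_cast hn2)
  rw [div_le_iff₀ hlogn]
  obtain ⟨S, hS1, hS2, hS3⟩ := hfin (n * m)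
  have : Module.Finite K S := Module.Finite.iff_fg.2 hS2
  have hdim : Module.finrank K ((1 ⊔ V) ^ n : Submodule K A) ≤ n ^ (Q + 1) := by
    refine (Submodule.finrank_mono ((hpow n).trans hS1)).trans (hS3.trans ?_)
    calc (2 * (n * m) + 1) ^ Q ≤ (n * (2 * m + 1)) ^ Q := Nat.pow_le_pow_left (by nlinarith) _
      _ = n ^ Q * (2 * m + 1) ^ Q := mul_pow _ _ _
      _ ≤ n ^ Q * n := Nat.mul_le_mul_left _ hnQ
      _ = n ^ (Q + 1) := (pow_succ _ _).symm
  -- The zero case covers the trivial algebra, where `Real.log 0 = 0`.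
  rcases Nat.eq_zero_or_pos (Module.finrank K ((1 ⊔ V) ^ n : Submodule K A)) with h0 | h0
  · rw [h0, Nat.cast_zero, Real.log_zero]; positivity
  · have := Real.log_le_log (Nat.cast_pos.2 h0)
      (show ((Module.finrank K ((1 ⊔ V) ^ n : Submodule K A) : ℕ) : ℝ) ≤ (n : ℝ) ^ (Q + 1) by
        exact_mod_cast hdim)
    rw [Real.log_pow] at this
    exact_mod_cast this

/-! ### Growth of proper quotients -/

section Quotient

variable {K : Type*} {A B : Type*} [Field K] [Ring A] [Algebra K A] [Ring B] [Algebra K B]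
  {Λ : Set ℤ} {e : ℤ → A}

theorem weightSpan_mul_mem {D m m' : ℕ} {x y : A} (hx : x ∈ weightSpan K Λ e D m)
    (hy : y ∈ weightSpan K Λ e D m') : x * y ∈ weightSpan K Λ e D (m + m') := by
  have h := Submodule.mul_mem_mul hx hy
  rw [weightSpan, weightSpan, Submodule.span_mul_span] at h
  refine Submodule.span_mono ?_ h
  rintro _ ⟨_, ⟨l, h1, h2, rfl⟩, _, ⟨l', h1', h2', rfl⟩, rfl⟩
  refine ⟨l ++ l', fun i hi => (List.mem_append.1 hi).elim (h1 i) (h1' i), ?_, by simp⟩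
  rw [absSum_append, List.length_append, mul_add]
  omega

theorem weightSpan_mono {D : ℕ} : Monotone (weightSpan K Λ e D) := fun _ _ h =>
  Submodule.span_mono fun _ ⟨l, h1, h2, h3⟩ => ⟨l, h1, h2.trans h, h3⟩

theorem one_mem_weightSpan {D : ℕ} : (1 : A) ∈ weightSpan K Λ e D 0 :=
  Submodule.subset_span ⟨[], by simp, by simp, by simp⟩

theorem exists_mem_weightSpan (hgen : Algebra.adjoin K (e '' Λ) = ⊤) (D : ℕ) (x : A) :
    ∃ m, x ∈ weightSpan K Λ e D m := by
  have hx : x ∈ Algebra.adjoin K (e '' Λ) := by rw [hgen]; trivial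
  induction hx using Algebra.adjoin_induction with
  | mem x hx =>
    obtain ⟨i, hi, rfl⟩ := hx
    exact ⟨_, Submodule.subset_span ⟨[i], by simpa using hi, le_rfl, by simp⟩⟩
  | algebraMap r =>
    rw [Algebra.algebraMap_eq_smul_one]
    exact ⟨0, Submodule.smul_mem _ _ one_mem_weightSpan⟩
  | add x y _ _ hx hy =>
    obtain ⟨m, hm⟩ := hx
    obtain ⟨m', hm'⟩ := hy
    exact ⟨max m m', add_mem (weightSpan_mono (le_max_left _ _) hm)
      (weightSpan_mono (le_max_right _ _) hm')⟩
  | mul x y _ _ hx hy =>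
    obtain ⟨m, hm⟩ := hx
    obtain ⟨m', hm'⟩ := hy
    exact ⟨_, weightSpan_mul_mem hm hm'⟩

theorem exists_mem_wordSpan (hgen : Algebra.adjoin K (e '' Λ) = ⊤) (x : A) :
    ∃ d w, x ∈ wordSpan K Λ e d w := by
  obtain ⟨m, hm⟩ := exists_mem_weightSpan hgen 1 x
  refine ⟨m + 1, m, Submodule.span_mono ?_ hm⟩
  rintro _ ⟨l, h1, h2, rfl⟩
  exact ⟨l, h1, by omega, by omega, rfl⟩

theorem wordSpan_succ_le (k w : ℕ) : wordSpan K Λ e (k + 1) w ≤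
    Submodule.span K (word e '' {v : Fin k → ℤ | (∀ s, v s ∈ Λ) ∧ ∑ s, (v s).natAbs ≤ w}) ⊔
      wordSpan K Λ e k w := by
  refine wordSpan_le_of_forall fun l h1 h2 h3 => ?_
  rcases (Nat.lt_succ_iff.1 h2).lt_or_eq with h | rfl
  · exact Submodule.mem_sup_right (prod_mem_wordSpan h1 h h3)
  · refine Submodule.mem_sup_left (Submodule.subset_span ⟨l.get, ⟨fun s => h1 _ (l.get_mem s), ?_⟩, ?_⟩)
    · rwa [← absSum_ofFn, List.ofFn_get]
    · rw [word, List.ofFn_get]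

/-- Express `x` by words of minimal maximal length `k` and average the top part over permutations.
This changes it, up to the factor `k!`, only by shorter words. -/
theorem WittRelations.exists_symmetric [CharZero K] {θ : ℤ → ℤ → K} (H : WittRelations Λ θ e)
    (hgen : Algebra.adjoin K (e '' Λ) = ⊤) {x : A} (hx : x ≠ 0) :
    ∃ (k w : ℕ) (g : (Fin k → ℤ) →₀ K), g ≠ 0 ∧
      (∀ (σ : Equiv.Perm (Fin k)) v, g (v ∘ σ) = g v) ∧ (∀ v ∈ g.support, ∀ s, v s ∈ Λ) ∧
      (∀ v ∈ g.support, ∑ s, (v s).natAbs ≤ w) ∧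
      ∃ c : K, Finsupp.linearCombination K (word e) g - c • x ∈ wordSpan K Λ e k w := by
  classical
  have hex := exists_mem_wordSpan hgen x
  obtain ⟨w, hw⟩ := Nat.find_spec hex
  have hmin := fun {d} => Nat.find_min hex (m := d)
  generalize Nat.find hex = d at hw hmin
  rcases d with _ | k
  · refine absurd ?_ hx
    have : wordSpan K Λ e 0 w ≤ ⊥ := wordSpan_le_of_forall fun l _ h => absurd h (Nat.not_lt_zero _)
    exact (Submodule.mem_bot K).1 (this hw)
  obtain ⟨y, hy, z, hz, rfl⟩ := Submodule.mem_sup.1 (wordSpan_succ_le k w hw)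
  obtain ⟨g₀, hg₀, rfl⟩ := (Finsupp.mem_span_image_iff_linearCombination K).1 hy
  rw [Finsupp.mem_supported] at hg₀
  set g : (Fin k → ℤ) →₀ K := ∑ σ : Equiv.Perm (Fin k),
    Finsupp.equivMapDomain (σ.arrowCongr (Equiv.refl ℤ)) g₀ with hg
  have hgv (v) : g v = ∑ σ : Equiv.Perm (Fin k), g₀ (v ∘ σ) := by
    rw [hg, Finsupp.finsetSum_apply]; rfl
  have hsupp (v) (hv : v ∈ g.support) : ∃ σ : Equiv.Perm (Fin k), v ∘ σ ∈ g₀.support := by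
    rw [Finsupp.mem_support_iff, hgv] at hv
    obtain ⟨σ, -, hσ⟩ := Finset.exists_ne_zero_of_sum_ne_zero hv
    exact ⟨σ, Finsupp.mem_support_iff.2 hσ⟩
  have hcomb : Finsupp.linearCombination K (word e) g -
      (Fintype.card (Equiv.Perm (Fin k)) : K) • Finsupp.linearCombination K (word e) g₀ ∈
        wordSpan K Λ e k w := by
    rw [hg, map_sum, Nat.cast_smul_eq_nsmul, ← Finset.card_univ, ← Finset.sum_const,
      ← Finset.sum_sub_distrib]
    refine Submodule.sum_mem _ fun σ _ => ?_
    rw [Finsupp.linearCombination_equivMapDomain, Finsupp.linearCombination_apply,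
      Finsupp.linearCombination_apply, Finsupp.sum, Finsupp.sum, ← Finset.sum_sub_distrib]
    refine Submodule.sum_mem _ fun v hv => ?_
    rw [← smul_sub]
    refine Submodule.smul_mem _ _ ?_
    have h := hg₀ hv
    rw [← neg_sub]
    have hv' : ∀ i ∈ List.ofFn v, i ∈ Λ := fun i hi => by
      obtain ⟨s, rfl⟩ := List.mem_ofFn.1 hi; exact h.1 s
    have := H.prod_sub_prod_mem_of_perm (Equiv.Perm.ofFn_comp_perm σ.symm v).symm hv'
    refine neg_mem (wordSpan_mono (by simp) ?_ this)
    rw [absSum_ofFn]; exact h.2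
  refine ⟨k, w, g, ?_, fun σ v => ?_, fun v hv s => ?_, fun v hv => ?_,
    (Fintype.card (Equiv.Perm (Fin k)) : K), ?_⟩
  -- If the symmetrised part vanished, `x` would be a combination of shorter words, against
  -- minimality. This replaces the PBW theorem.
  · intro h0
    rw [h0, map_zero, zero_sub, neg_mem_iff] at hcomb
    have := (Submodule.smul_mem_iff _ (Nat.cast_ne_zero.2 Fintype.card_ne_zero)).1 hcomb
    exact hmin (Nat.lt_succ_self k) ⟨w, add_mem this hz⟩
  · rw [hgv, hgv]
    exact Equiv.sum_comp (Equiv.mulLeft σ) fun τ : Equiv.Perm (Fin k) => g₀ (v ∘ τ)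
  · obtain ⟨σ, hσ⟩ := hsupp v hv
    simpa using (hg₀ hσ).1 (σ.symm s)
  · obtain ⟨σ, hσ⟩ := hsupp v hv
    rw [← Equiv.sum_comp σ]
    exact (hg₀ hσ).2
  · have := sub_mem hcomb (Submodule.smul_mem _ (Fintype.card (Equiv.Perm (Fin k)) : K) hz)
    rwa [sub_sub, ← smul_add] at this

theorem WittRelations.map {θ : ℤ → ℤ → K} (H : WittRelations Λ θ e) (π : A →ₐ[K] B) :
    WittRelations Λ θ (π ∘ e) where
  add_closed := H.add_closed
  commutator i hi j hj := by
    have := congrArg π (H.commutator i hi j hj)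
    simpa using this

theorem map_word {k : ℕ} (π : A →ₐ[K] B) (v : Fin k → ℤ) : π (word e v) = word (π ∘ e) v := by
  simp only [word, map_list_prod, List.map_map]

theorem map_mem_wordSpan (π : A →ₐ[K] B) {d w : ℕ} {x : A} (hx : x ∈ wordSpan K Λ e d w) :
    π x ∈ wordSpan K Λ (π ∘ e) d w := by
  have : wordSpan K Λ e d w ≤ (wordSpan K Λ (π ∘ e) d w).comap π.toLinearMap :=
    wordSpan_le_of_forall fun l h1 h2 h3 => by
      have := prod_mem_wordSpan (K := K) (e := π ∘ e) h1 h2 h3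
      rw [← List.map_map, ← map_list_prod] at this
      exact this
  exact this hx

theorem WittRelations.gkDim_lt_top [CharZero K] {θ : ℤ → ℤ → K} (H : WittRelations Λ θ e)
    (hstable : ∀ (C : ℕ), ∀ i ∈ Λ, C < i.natAbs → ∀ t : ℤ, t.natAbs ≤ C → i + t ∈ Λ)
    (hgen : Algebra.adjoin K (e '' Λ) = ⊤) (π : A →ₐ[K] B) (hπ : Function.Surjective π) {x : A}
    (hx : x ≠ 0) (hπx : π x = 0) : gkDim K B < ⊤ := by
  obtain ⟨k, w, g, hg0, hsymm, hΛ, hw, c, hc⟩ := H.exists_symmetric hgen hx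
  have hg : ∑ v ∈ g.support, g v • word (π ∘ e) v ∈ wordSpan K Λ (π ∘ e) k w := by
    have := map_mem_wordSpan π hc
    rw [map_sub, map_smul, hπx, smul_zero, sub_zero, Finsupp.linearCombination_apply, Finsupp.sum,
      map_sum] at this
    simpa only [map_smul, map_word] using this
  obtain ⟨C, hC⟩ := (H.map π).exists_word_mem hstable hg0 hsymm hΛ hw hg
  obtain ⟨Q, hQ⟩ := exists_weightSpan_le (H.map π) hC
  have hgen' : Algebra.adjoin K ((π ∘ e) '' Λ) = ⊤ := by
    rw [Set.image_comp, ← AlgHom.map_adjoin, hgen, Algebra.map_top, AlgHom.range_eq_top]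
    exact hπ
  exact gkDim_lt_top_of_filtration Q (weightSpan K Λ (π ∘ e) (C + 1)) weightSpan_mono
    one_mem_weightSpan (fun _ _ _ _ => weightSpan_mul_mem) (exists_mem_weightSpan hgen' _) hQ

theorem WittRelations.hasJustInfiniteGKDim [CharZero K] {θ : ℤ → ℤ → K} (H : WittRelations Λ θ e)
    (hstable : ∀ (C : ℕ), ∀ i ∈ Λ, C < i.natAbs → ∀ t : ℤ, t.natAbs ≤ C → i + t ∈ Λ)
    (hgen : Algebra.adjoin K (e '' Λ) = ⊤) (φ : A →ₐ[K] Module.End K (MvPolynomial ℤ K)) (b : K)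
    (hφ : ∀ n : ℕ, φ (e (n + 1)) = PolynomialRep.op b (n + 1)) : HasJustInfiniteGKDim K A := by
  refine ⟨gkDim_eq_top fun d => ⟨fun s => e ((s : ℕ) + 1), ?_⟩, fun I hI => ?_⟩
  · refine LinearIndependent.of_comp φ.toLinearMap ?_
    have h : (φ.toLinearMap ∘ fun a : Fin d → ℕ =>
        (List.ofFn fun s => e ((s : ℕ) + 1) ^ a s).prod) =
        fun a => (List.ofFn fun s : Fin d => PolynomialRep.op b ((s : ℕ) + 1 : ℤ) ^ a s).prod := by
      funext a
      simp [map_list_prod, List.map_ofFn, Function.comp_def, hφ]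
    rw [h]
    exact PolynomialRep.linearIndependent_prod b d
  · obtain ⟨x, hxI, hx⟩ : ∃ x ∈ I, x ≠ 0 := by
      by_contra! h
      exact hI (le_bot_iff.1 fun x hx => (TwoSidedIdeal.mem_bot A).2 (h x hx))
    refine H.gkDim_lt_top hstable hgen (I.ringCon.mkₐ K) (RingCon.mkₐ_surjective I.ringCon) hx ?_
    have := (TwoSidedIdeal.mem_iff I x).1 hxI
    exact (RingCon.eq I.ringCon).2 this

end Quotient

/-! ### The enveloping algebras of the Witt and Virasoro algebras -/

section Enveloping

variable {K : Type*} [Field K]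

attribute [local instance 100] LieRing.ofAssociativeRing

/-- Lift the Lie algebra map into the generated subalgebra; followed by the inclusion, the lift is
the identity by uniqueness. -/
theorem UniversalEnvelopingAlgebra.adjoin_range_ι (L : Type*) [LieRing L] [LieAlgebra K L] :
    Algebra.adjoin K (Set.range (ι K : L → UniversalEnvelopingAlgebra K L)) = ⊤ := by
  set S := Algebra.adjoin K (Set.range (ι K : L → UniversalEnvelopingAlgebra K L))
  let f : L →ₗ⁅K⁆ S :=
    { toFun := fun x => ⟨ι K x, Algebra.subset_adjoin ⟨x, rfl⟩⟩
      map_add' := fun x y => Subtype.ext (map_add _ x y)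
      map_smul' := fun r x => Subtype.ext (map_smul _ r x)
      map_lie' := fun {x y} => Subtype.ext (LieHom.map_lie _ x y) }
  have h : S.val.comp (lift K f) = AlgHom.id K _ := by
    refine hom_ext K (LieHom.ext fun x => ?_)
    change ((lift K f (ι K x) : S) : UniversalEnvelopingAlgebra K L) = ι K x
    rw [lift_ι_apply]
    rfl
  refine eq_top_iff.2 fun x _ => ?_
  rw [← AlgHom.id_apply (R := K) x, ← h]
  exact (lift K f x).2

/-- Adjoining the images of a spanning set of the Lie algebra gives the enveloping algebra. -/
theorem UniversalEnvelopingAlgebra.adjoin_eq_top {L : Type*} [LieRing L] [LieAlgebra K L]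
    {S : Subalgebra K (UniversalEnvelopingAlgebra K L)} {s : Set L} (hs : Submodule.span K s = ⊤)
    (h : ∀ x ∈ s, ι K x ∈ S) : S = ⊤ := by
  rw [eq_top_iff, ← adjoin_range_ι, Algebra.adjoin_le_iff]
  rintro _ ⟨x, rfl⟩
  have hle : Submodule.span K s ≤
      S.toSubmodule.comap (ι K : L →ₗ⁅K⁆ UniversalEnvelopingAlgebra K L).toLinearMap :=
    Submodule.span_le.2 h
  exact hle (hs ▸ Submodule.mem_top)

theorem UniversalEnvelopingAlgebra.ι_commutator {L : Type*} [LieRing L] [LieAlgebra K L] (x y : L) :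
    ι K x * ι K y - ι K y * ι K x = ι K ⁅x, y⁆ := by
  rw [LieHom.map_lie, LieRing.of_associative_ring_bracket]

namespace WittAlgebra

theorem span_e : Submodule.span K (Set.range (e K)) = ⊤ := (basis K).span_eq

/-- The projective representation of the Witt algebra on polynomials. -/
noncomputable def polyRep (b : K) : WittAlgebra K →ₗ[K] Module.End K (MvPolynomial ℤ K) :=
  (basis K).constr K (PolynomialRep.op b)

theorem polyRep_e (b : K) (n : ℤ) : polyRep b (e K n) = PolynomialRep.op b n :=
  (basis K).constr_basis K _ n

theorem polyRep_commutator [CharZero K] (κ : K) (x y : WittAlgebra K) :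
    polyRep (-κ / 24) x * polyRep (-κ / 24) y - polyRep (-κ / 24) y * polyRep (-κ / 24) x =
      polyRep (-κ / 24) ⁅x, y⁆ + (VirasoroAlgebra.cocycle K x y * κ) • 1 := by
  induction x using induction_e with
  | zero => simp
  | add x x' hx hx' =>
    simp only [map_add, LinearMap.add_apply, add_lie, add_mul, mul_add, add_smul]
    rw [add_sub_add_comm, hx, hx']
    abel
  | smul r i =>
  induction y using induction_e with
  | zero => simp
  | add y y' hy hy' =>
    simp only [map_add, lie_add, add_mul, mul_add, add_smul]
    rw [add_sub_add_comm, hy, hy']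
    abel
  | smul s j =>
  simp only [smul_lie, lie_smul, map_smul, LinearMap.smul_apply, lie_e_e, polyRep_e,
    VirasoroAlgebra.cocycle_e, smul_mul_assoc, mul_smul_comm, smul_eq_mul]
  have h := congrArg (fun T => (s * r) • T) (PolynomialRep.op_commutator κ i j)
  simp only [sub_eq_add_neg, smul_add, smul_neg, mul_smul] at h ⊢
  rw [smul_comm r s]
  exact h

/-- The representation of the Witt algebra on polynomials, with trivial central charge. -/
noncomputable def polyLieRep [CharZero K] : WittAlgebra K →ₗ⁅K⁆ Module.End K (MvPolynomial ℤ K) :=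
  -- The parameter is left as `-0 / 24` to match the commutator formula at `κ = 0`.
  { polyRep (-0 / 24 : K) with
    map_lie' := fun {x y} => by
      have := polyRep_commutator (0 : K) x y
      rw [mul_zero, zero_smul, add_zero] at this
      exact this.symm }

theorem polyLieRep_e [CharZero K] (n : ℤ) :
    polyLieRep (e K n) = PolynomialRep.op (-0 / 24) n := polyRep_e _ n

theorem wittRelations_ι : WittRelations (K := K) Set.univ (fun _ _ => 0)
    fun n => UniversalEnvelopingAlgebra.ι K (e K n) where
  add_closed _ _ _ _ := trivial
  commutator i _ j _ := by
    rw [UniversalEnvelopingAlgebra.ι_commutator, lie_e_e, map_smul, map_zero, add_zero]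

theorem hasJustInfiniteGKDim [CharZero K] :
    HasJustInfiniteGKDim K (UniversalEnvelopingAlgebra K (WittAlgebra K)) := by
  refine wittRelations_ι.hasJustInfiniteGKDim (fun _ _ _ _ _ _ => trivial) ?_
    (UniversalEnvelopingAlgebra.lift K polyLieRep) (-0 / 24) fun n => ?_
  · refine UniversalEnvelopingAlgebra.adjoin_eq_top span_e ?_
    rintro _ ⟨n, rfl⟩
    exact Algebra.subset_adjoin ⟨n, trivial, rfl⟩
  · rw [UniversalEnvelopingAlgebra.lift_ι_apply, polyLieRep_e]

end WittAlgebra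

namespace positiveWittAlgebra

/-- The basis vector `e n`, or zero if `n < 1`. -/
noncomputable def e (K : Type*) [Field K] (n : ℤ) : positiveWittAlgebra K :=
  if h : 1 ≤ n then ⟨WittAlgebra.e K n, Submodule.subset_span ⟨n, h, rfl⟩⟩ else 0

theorem coe_e {n : ℤ} (h : 1 ≤ n) : (e K n : WittAlgebra K) = WittAlgebra.e K n := by
  rw [e, dif_pos h]

theorem span_e : Submodule.span K (e K '' Set.Ici 1) = ⊤ := by
  refine Submodule.map_injective_of_injective (f := (positiveWittAlgebra K).toSubmodule.subtype)
    Subtype.val_injective ?_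
  rw [Submodule.map_top, Submodule.range_subtype, Submodule.map_span, ← Set.image_comp]
  change _ = Submodule.span K (WittAlgebra.e K '' Set.Ici 1)
  congr 1
  exact Set.image_congr fun n hn => coe_e hn

theorem wittRelations_ι : WittRelations (K := K) (Set.Ici 1) (fun _ _ => 0)
    fun n => UniversalEnvelopingAlgebra.ι K (e K n) where
  add_closed i hi j hj := by simp only [Set.mem_Ici] at hi hj ⊢; omega
  commutator i hi j hj := by
    simp only [Set.mem_Ici] at hi hj
    have h : ⁅e K i, e K j⁆ = ((j : K) - (i : K)) • e K (i + j) := by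
      refine Subtype.ext ?_
      rw [LieSubalgebra.coe_bracket, SetLike.val_smul, coe_e hi, coe_e hj,
        coe_e (by omega), WittAlgebra.lie_e_e]
    rw [UniversalEnvelopingAlgebra.ι_commutator, h, map_smul, map_zero, add_zero]

theorem hasJustInfiniteGKDim [CharZero K] :
    HasJustInfiniteGKDim K (UniversalEnvelopingAlgebra K (positiveWittAlgebra K)) := by
  refine wittRelations_ι.hasJustInfiniteGKDim (fun C i hi h t ht => ?_) ?_
    (UniversalEnvelopingAlgebra.lift K
      (WittAlgebra.polyLieRep.comp (positiveWittAlgebra K).incl)) (-0 / 24) fun n => ?_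
  · simp only [Set.mem_Ici] at hi ⊢; omega
  · refine UniversalEnvelopingAlgebra.adjoin_eq_top span_e ?_
    rintro _ ⟨n, hn, rfl⟩
    exact Algebra.subset_adjoin ⟨n, hn, rfl⟩
  · rw [UniversalEnvelopingAlgebra.lift_ι_apply, LieHom.comp_apply, LieSubalgebra.coe_incl,
      coe_e (by omega), WittAlgebra.polyLieRep_e]

end positiveWittAlgebra

namespace VirasoroAlgebra

theorem span_e : Submodule.span K (Set.range (e K) ∪ {c K}) = ⊤ := by
  refine eq_top_iff.2 fun x _ => ?_
  let f : WittAlgebra K →ₗ[K] VirasoroAlgebra K := LinearMap.inl K (WittAlgebra K) K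
  have h : x = f x.1 + x.2 • c K := by
    refine Prod.ext ?_ ?_
    · change x.1 = x.1 + x.2 • (0 : WittAlgebra K)
      rw [smul_zero, add_zero]
    · change x.2 = 0 + x.2 * 1
      rw [mul_one, zero_add]
  rw [h]
  refine add_mem ?_ (Submodule.smul_mem _ _ (Submodule.subset_span (Or.inr rfl)))
  have hle : Submodule.span K (Set.range (WittAlgebra.e K)) ≤
      (Submodule.span K (Set.range (e K) ∪ {c K})).comap f :=
    Submodule.span_le.2 (by
      rintro _ ⟨n, rfl⟩
      exact Submodule.subset_span (Or.inl ⟨n, rfl⟩))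
  exact hle (WittAlgebra.span_e (K := K) ▸ Submodule.mem_top)

/-- The representation of the Virasoro algebra on polynomials, with central charge `κ`. -/
noncomputable def polyLieRep [CharZero K] (κ : K) :
    VirasoroAlgebra K →ₗ⁅K⁆ Module.End K (MvPolynomial ℤ K) where
  toFun x := WittAlgebra.polyRep (-κ / 24) x.1 + (x.2 * κ) • 1
  map_add' x y := by
    change WittAlgebra.polyRep (-κ / 24) (x.1 + y.1) + ((x.2 + y.2) * κ) • 1 = _
    rw [map_add, add_mul, add_smul]
    abel
  map_smul' r x := by
    change WittAlgebra.polyRep (-κ / 24) (r • x.1) + ((r * x.2) * κ) • 1 = _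
    rw [map_smul, mul_assoc, mul_smul, RingHom.id_apply, smul_add]
  map_lie' {x y} := by
    change WittAlgebra.polyRep (-κ / 24) ⁅x.1, y.1⁆ + (cocycle K x.1 y.1 * κ) • 1 = _
    rw [← WittAlgebra.polyRep_commutator, LieRing.of_associative_ring_bracket]
    simp only [add_mul, mul_add, smul_mul_assoc, mul_smul_comm, one_mul, mul_one, smul_add,
      smul_comm (y.2 * κ) (x.2 * κ)]
    abel

theorem polyLieRep_e [CharZero K] (κ : K) (n : ℤ) :
    polyLieRep κ (e K n) = PolynomialRep.op (-κ / 24) n := by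
  change WittAlgebra.polyRep (-κ / 24) (WittAlgebra.e K n) + ((0 : K) * κ) • 1 = _
  rw [WittAlgebra.polyRep_e, zero_mul, zero_smul, add_zero]

theorem polyLieRep_c [CharZero K] (κ : K) : polyLieRep κ (c K) = κ • 1 := by
  change WittAlgebra.polyRep (-κ / 24) 0 + ((1 : K) * κ) • 1 = _
  rw [map_zero, one_mul, zero_add]

/-- The quotient map to the central quotient. -/
noncomputable def toCentralQuotient (κ : K) :
    UniversalEnvelopingAlgebra K (VirasoroAlgebra K) →ₐ[K] VirasoroCentralQuotient K κ :=
  RingCon.mkₐ K _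

theorem toCentralQuotient_c (κ : K) :
    toCentralQuotient κ (UniversalEnvelopingAlgebra.ι K (c K)) = algebraMap K _ κ := by
  have h := (TwoSidedIdeal.mem_iff _ _).1 (TwoSidedIdeal.subset_span (Set.mem_singleton
    (UniversalEnvelopingAlgebra.ι K (c K) -
      algebraMap K (UniversalEnvelopingAlgebra K (VirasoroAlgebra K)) κ)))
  have h' := (RingCon.eq _).2 h
  rw [← (toCentralQuotient κ).commutes, ← sub_eq_zero, ← map_sub]
  exact h'

theorem wittRelations_toCentralQuotient (κ : K) : WittRelations (K := K) Set.univ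
    (fun i j => (if i + j = 0 then ((i : K) ^ 3 - (i : K)) / 12 else 0) * κ)
    fun n => toCentralQuotient κ (UniversalEnvelopingAlgebra.ι K (e K n)) where
  add_closed _ _ _ _ := trivial
  commutator i _ j _ := by
    have h := congrArg (toCentralQuotient κ)
      (UniversalEnvelopingAlgebra.ι_commutator (K := K) (e K i) (e K j))
    rw [lie_e_e, map_add, map_smul, map_smul, map_add, map_smul, map_smul, toCentralQuotient_c,
      Algebra.smul_def _ (algebraMap K _ κ), map_sub, map_mul (toCentralQuotient κ),
      map_mul (toCentralQuotient κ)] at h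
    rw [map_mul, h]

theorem hasJustInfiniteGKDim [CharZero K] (κ : K) :
    HasJustInfiniteGKDim K (VirasoroCentralQuotient K κ) := by
  -- The representation descends to the quotient because `c` acts as the scalar `κ`.
  let φ : VirasoroCentralQuotient K κ →ₐ[K] Module.End K (MvPolynomial ℤ K) :=
    RingCon.liftₐ _ (UniversalEnvelopingAlgebra.lift K (polyLieRep κ)) fun x y h => by
      have hle : TwoSidedIdeal.span {UniversalEnvelopingAlgebra.ι K (c K) -
          algebraMap K (UniversalEnvelopingAlgebra K (VirasoroAlgebra K)) κ} ≤
            TwoSidedIdeal.ker (UniversalEnvelopingAlgebra.lift K (polyLieRep κ)) := by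
        rw [TwoSidedIdeal.span_le, Set.singleton_subset_iff, SetLike.mem_coe,
          TwoSidedIdeal.mem_ker, map_sub, UniversalEnvelopingAlgebra.lift_ι_apply, polyLieRep_c,
          AlgHom.commutes, Algebra.algebraMap_eq_smul_one, sub_self]
      have := (TwoSidedIdeal.mem_ker _).1 (hle ((TwoSidedIdeal.rel_iff _ _ _).1 h))
      rw [map_sub] at this
      exact sub_eq_zero.1 this
  refine (wittRelations_toCentralQuotient κ).hasJustInfiniteGKDim (fun _ _ _ _ _ _ => trivial) ?_
    φ (-κ / 24) fun n => ?_
  · set S := Algebra.adjoin K ((fun n => toCentralQuotient κ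
      (UniversalEnvelopingAlgebra.ι K (e K n))) '' Set.univ)
    have h : S.comap (toCentralQuotient κ) = ⊤ := by
      refine UniversalEnvelopingAlgebra.adjoin_eq_top span_e ?_
      rintro _ (⟨n, rfl⟩ | rfl)
      · exact Algebra.subset_adjoin ⟨n, trivial, rfl⟩
      -- In the quotient `c` is a scalar, so the images of the `e n` alone generate.
      · change toCentralQuotient κ (UniversalEnvelopingAlgebra.ι K (c K)) ∈ S
        rw [toCentralQuotient_c]
        exact S.algebraMap_mem κ
    refine eq_top_iff.2 fun x _ => ?_
    obtain ⟨y, rfl⟩ := RingCon.mkₐ_surjective (α := K) _ x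
    exact (h ▸ Algebra.mem_top : y ∈ S.comap (toCentralQuotient κ))
  · change UniversalEnvelopingAlgebra.lift K (polyLieRep κ) (UniversalEnvelopingAlgebra.ι K _) = _
    rw [UniversalEnvelopingAlgebra.lift_ι_apply, polyLieRep_e]

end VirasoroAlgebra

end Enveloping

theorem mainTheorem1 (K : Type*) [Field K] [CharZero K] :
    HasJustInfiniteGKDim K (UniversalEnvelopingAlgebra K (positiveWittAlgebra K)) ∧
      HasJustInfiniteGKDim K (UniversalEnvelopingAlgebra K (WittAlgebra K)) ∧
      ∀ κ : K, HasJustInfiniteGKDim K (VirasoroCentralQuotient K κ) :=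
  ⟨positiveWittAlgebra.hasJustInfiniteGKDim, WittAlgebra.hasJustInfiniteGKDim,
    VirasoroAlgebra.hasJustInfiniteGKDim⟩
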